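/- Call $w:\mathbb N\to\mathbb R$ a submodular rule if $w(0)=0$, $w(j)>0$ for $j\ge 1$, and the increments $w(j+1)-w(j)$, $j\ge 0$, are non-negative and non-increasing in $j$. Its curvature is $1-\lim_{n\to\infty}(w(n+1)-w(n))/w(1)$. Fix $c\in[0,1]$ and let $\mathcal W$ be the set of all submodular rules of curvature at most $c$. A utility design $\Gamma$ assigns to every $w\in\mathcal W$ a submodular rule $\Gamma(w)$ with $\Gamma(w)(1)=w(1)$. A game consists of agents $1,\dots,n$, a finite set $R$ of resources with welfare rules $w_r\in\mathcal W$, and non-empty action sets $\mathcal A_i\subseteq 2^R$. For an allocation $a=(a_1,\dots,a_n)$ of subsets of $R$ let $|a|_r=|\{i: r\in a_i\}|$, $W(a)=\sum_{r\in R} w_r(|a|_r)$ and $U(a)=\sum_{r\in R}\Gamma(w_r)(|a|_r)$; only games with $\max_{a\in\mathcal A_1\times\dots\times\mathcal A_n}W(a)>0$ are considered. In the round-robin walk all agents start with $\varnothing$, and the agents $1,\dots,n,1,\dots,n,\dots$ in turn replace their current set by a best response, i.e. by an element of $\mathcal A_i$ that maximizes $U$ given the current sets of the other agents. The $k$-round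 efficiency of the game is the minimum of $W$ over the allocations that can result after $k$ rounds (over all ways of breaking ties), divided by $\max_{a}W(a)$; its asymptotic efficiency is the minimum of $W$ over all limits, as $k\to\infty$, of allocations after $k$ rounds of walks for which this limit exists (i.e. the allocation is eventually the same at the end of every round), divided by $\max_a W(a)$. Let $\mathrm{Eff}(\Gamma;k)$ and $\mathrm{Eff}(\Gamma;\infty)$ be the infima of these quantities over all games, and let $\mathrm{Eff}^*(k)$ and $\mathrm{Eff}^*(\infty)$ be the suprema of these infima over all utility designs $\Gamma$. **Theorem.** The suprema $\mathrm{Eff}^*(1)$ and $\mathrm{Eff}^*(\infty)$ are attained. For every utility design $\Gamma_1^*$ with $\mathrm{Eff}(\Gamma_1^*;1)=\mathrm{Eff}^*(1)$ and every utility design $\Gamma_\infty^*$ with $\mathrm{Eff}(\Gamma^*_\infty;\infty)=\mathrm{Eff}^*(\infty)$, $$\mathrm{Eff}(\Gamma_1^*;\infty)=\mathrm{Eff}^*(1)=1-\frac c2,\qquad \mathrm{Eff}(\Gamma_\infty^*;1)\le 1+\frac{(c-3)c}{(2-c)e+c}.$$ Moreover $\mathrm{Eff}(\Gamma_\infty^*;1)<\mathrm{Eff}^*(1)$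 if $c>0$, and $\mathrm{Eff}(\Gamma_\infty^*;1)=0$ if $c=1$. -/

import Mathlib

open Filter Topology

noncomputable section

namespace ResourceAllocation

/-- A rule `ℕ → ℝ`, positive on positive arguments, with value `0` at `0`, non-decreasing and
concave (its increments, the one from `0` to `1` included, are non-increasing). Both the submodular
welfare rules and the distribution rules are of this kind. -/
structure IsSubmodularRule (w : ℕ → ℝ) : Prop where
  map_zero : w 0 = 0
  pos : ∀ j, 0 < j → 0 < w j
  mono : Monotone w
  concave : ∀ j, w (j + 2) - w (j + 1) ≤ w (j + 1) - w j

/-- `w` has curvature `κ = 1 - lim (w (n + 1) - w n) / w 1`. -/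
def HasCurvature (w : ℕ → ℝ) (κ : ℝ) : Prop :=
  Tendsto (fun n : ℕ => 1 - (w (n + 1) - w n) / w 1) atTop (𝓝 κ)

/-- All submodular welfare rules of curvature at most `c`. -/
def curvatureClass (c : ℝ) : Set (ℕ → ℝ) :=
  {w | IsSubmodularRule w ∧ ∃ κ, κ ≤ c ∧ HasCurvature w κ}

/-- A utility design on a set `𝒲` of welfare rules: to every welfare rule it assigns a
non-decreasing concave distribution rule with the same value at `1`. -/
structure UtilityDesign (𝒲 : Set (ℕ → ℝ)) where
  rule : 𝒲 → ℕ → ℝ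
  isRule : ∀ w, IsSubmodularRule (rule w)
  rule_one : ∀ w : 𝒲, rule w 1 = (w : ℕ → ℝ) 1

/-- A resource allocation problem with `n` agents and `d` resources whose welfare rules belong to
`𝒲`. Together with a utility design it determines a game. The field `nontrivial` says that
the maximal welfare is positive, so that the efficiency ratio makes sense. -/
structure Game (𝒲 : Set (ℕ → ℝ)) where
  n : ℕ
  d : ℕ
  welfareRule : Fin d → 𝒲
  actions : Fin n → Finset (Finset (Fin d))
  actions_nonempty : ∀ i, (actions i).Nonempty
  nontrivial : ∃ i, ∃ s ∈ actions i, s.Nonempty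

namespace Game

variable {𝒲 : Set (ℕ → ℝ)}

/-- An allocation of sets of resources to the agents (not necessarily of allowed sets, since
the walk starts from the allocation in which nobody uses any resource). -/
abbrev Allocation (G : Game 𝒲) : Type := Fin G.n → Finset (Fin G.d)

/-- The joint actions, that is, the allocations of allowed sets of resources. -/
def jointActions (G : Game 𝒲) : Set G.Allocation :=
  {a | ∀ i, a i ∈ G.actions i}

/-- The number `|a|_r` of agents that use the resource `r`. -/
def load (G : Game 𝒲) (a : G.Allocation) (r : Fin G.d) : ℕ :=
  (Finset.univ.filter (fun i => r ∈ a i)).card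

/-- The system welfare `W(a) = ∑ r, w_r (|a|_r)`. -/
def welfare (G : Game 𝒲) (a : G.Allocation) : ℝ :=
  ∑ r, (G.welfareRule r : ℕ → ℝ) (G.load a r)

/-- The utility `U(a) = ∑ r, Γ(w_r) (|a|_r)` that each agent maximizes. -/
def utility (G : Game 𝒲) (Γ : UtilityDesign 𝒲) (a : G.Allocation) : ℝ :=
  ∑ r, Γ.rule (G.welfareRule r) (G.load a r)

/-- The best responses of agent `i` to the actions of the other agents in `a`. -/
def bestResponses (G : Game 𝒲) (Γ : UtilityDesign 𝒲) (i : Fin G.n) (a : G.Allocation) :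
    Set (Finset (Fin G.d)) :=
  {s | s ∈ G.actions i ∧ ∀ s' ∈ G.actions i,
    G.utility Γ (Function.update a i s') ≤ G.utility Γ (Function.update a i s)}

/-- A round-robin best response walk: it starts from the empty allocation, and in step `t` the
agent with number `t % n` (agents being numbered from `0`) moves to some best response. -/
def IsWalk (G : Game 𝒲) (Γ : UtilityDesign 𝒲) (a : ℕ → G.Allocation) : Prop :=
  (∀ i, a 0 i = ∅) ∧
    ∀ (t : ℕ) (i : Fin G.n),
      ((i : ℕ) = t % G.n → a (t + 1) i ∈ G.bestResponses Γ i (a t)) ∧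
      ((i : ℕ) ≠ t % G.n → a (t + 1) i = a t i)

/-- The possible results of the walk after `k` rounds (several ones if there are ties between
best responses). -/
def outcomes (G : Game 𝒲) (Γ : UtilityDesign 𝒲) (k : ℕ) : Set G.Allocation :=
  {α | ∃ a, G.IsWalk Γ a ∧ a (k * G.n) = α}

/-- The possible limits, as the number `k` of rounds tends to infinity, of the result of
the walk after `k` rounds. The allocations form a discrete space, so that a sequence converges
to `α` when it is eventually equal to `α`. -/
def limitOutcomes (G : Game 𝒲) (Γ : UtilityDesign 𝒲) : Set G.Allocation :=
  {α | ∃ a, G.IsWalk Γ a ∧ ∀ᶠ k : ℕ in atTop, a (k * G.n) = α}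

/-- The maximal welfare of a joint action (a maximum over a finite non-empty set). -/
def optWelfare (G : Game 𝒲) : ℝ :=
  sSup (G.welfare '' G.jointActions)

/-- The efficiency of the `k`-round walk: the least welfare of a possible result (a minimum
over a finite non-empty set), relative to the maximal welfare. -/
def efficiency (G : Game 𝒲) (Γ : UtilityDesign 𝒲) (k : ℕ) : ℝ :=
  sInf (G.welfare '' G.outcomes Γ k) / G.optWelfare

/-- The asymptotic efficiency: the least welfare of a possible limit (a minimum over a finite
non-empty set), relative to the maximal welfare. -/
def asymptoticEfficiency (G : Game 𝒲) (Γ : UtilityDesign 𝒲) : ℝ :=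
  sInf (G.welfare '' G.limitOutcomes Γ) / G.optWelfare

end Game

namespace UtilityDesign

variable {𝒲 : Set (ℕ → ℝ)}

/-- The `k`-round efficiency guarantee of a design: the infimum over all games. -/
def efficiency (Γ : UtilityDesign 𝒲) (k : ℕ) : ℝ :=
  ⨅ G : Game 𝒲, G.efficiency Γ k

/-- The asymptotic efficiency guarantee of a design: the infimum over all games. -/
def asymptoticEfficiency (Γ : UtilityDesign 𝒲) : ℝ :=
  ⨅ G : Game 𝒲, G.asymptoticEfficiency Γ

end UtilityDesign

/-- The optimal `k`-round efficiency guarantee over all utility designs. -/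
def optEfficiency (𝒲 : Set (ℕ → ℝ)) (k : ℕ) : ℝ :=
  ⨆ Γ : UtilityDesign 𝒲, Γ.efficiency k

/-- The optimal asymptotic efficiency guarantee over all utility designs. -/
def optAsymptoticEfficiency (𝒲 : Set (ℕ → ℝ)) : ℝ :=
  ⨆ Γ : UtilityDesign 𝒲, Γ.asymptoticEfficiency

end ResourceAllocation

end

/-!
For a resource with welfare rule `w`, write `F = Γ(w)` and let `φ(j) = F(j + 1) - F(j)` be the gain of
an agent that joins `j` others. Both guarantees are governed by inequalities for each `w` separately.

*Sufficiency.* Let `α` be the result and `o` an optimal allocation. Adding up what the agents gain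
when they move in the first round gives `∑ |o|_r φ_r(|α|_r) ≤ ∑ F_r(|α|_r)`. A limit of a walk is a
Nash equilibrium, because each agent moves once per round, and adding up the equilibrium conditions
gives the same with `|α|_r φ_r(|α|_r - 1)` in place of `F_r(|α|_r)`. Hence `ρ` is a guarantee if
`ρ w(o) ≤ ρ (o φ(a) - F(a)) + w(a)` for all `w`, `a`, `o`, and similarly for equilibria
(`UtilityDesign.le_efficiency_one`, `UtilityDesign.le_asymptoticEfficiency`).

*Necessity.* Conversely, given finitely many resource types with numbers `a_r` of users and `o_r` of
alternative users that satisfy the summed inequality, copies of these resources are put along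
a long chain of agents, such that each agent uses `a_r` consecutive copies and could use instead
`o_r` copies that earlier agents have filled. In this game every agent may take its `a`-set in the
first round, and these sets also form an equilibrium in the second case. Since the boundary effects
vanish in the limit, the guarantee `ρ` satisfies `ρ ∑ w_r(o_r) ≤ ∑ w_r(a_r)`
(`efficiency_one_mul_sum_le`, `asymptoticEfficiency_mul_sum_le`). As `φ(0) = w(1)` is prescribed,
unused alternatives of the right value at `1` turn this into a condition on a single `w`
(`efficiency_one_mul_add_le`, `asymptoticEfficiency_mul_add_le`). It also follows
that the asymptotic guarantee of a design is at least its guarantee after one round.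

*One round.* The design `F(j) = (w(j) + (1 - c) w(1) j) / (2 - c)` guarantees `1 - c / 2`. For the
extreme rule `(1 - c) j + c min(j, 1)`, two users and one alternative user show that no
design does better, and designs that attain this have `φ(1) ≤ (2 - 2 c) / (2 - c)`, which produces an
equilibrium of efficiency `1 - c / 2`.

*Equilibria.* For the extreme rule and one alternative user, the necessary condition is a
recursion: `γ(m) = ρ φ(m) - (1 - c)` satisfies `γ(m + 1) ≥ (m + 1) γ(m) - (1 - ρ)`. As `φ` is bounded, `γ`
is at most `1 - ρ` times the solution `m! ∑_{k > m} 1 / k!` (`expTail`), and `m = 0` gives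
`ρ ≤ 1 - c / e`. If equality holds, then `φ` is determined, and the one-round condition with two users
and one alternative user is the claimed bound. For `c = 1` the forced `φ` decays only like the harmonic
series; the utility `F` is then unbounded although the welfare is `1`, and the one-round guarantee is
`0`. A design that attains `1 - c / e` is obtained by stretching `expTail` by the factor `b` to obtain
marginals for `min(j, b)`, and by writing a concave rule as a combination of a linear rule and
of rules of this form (`mixtureMarginal`).
-/
open Filter Topology

namespace ResourceAllocation

/-! ### Submodular rules and marginal utilities -/

theorem IsSubmodularRule.nonneg {w : ℕ → ℝ} (hw : IsSubmodularRule w) (j : ℕ) : 0 ≤ w j := by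
  simpa [hw.map_zero] using hw.mono (Nat.zero_le j)

theorem IsSubmodularRule.increment_nonneg {w : ℕ → ℝ} (hw : IsSubmodularRule w) (j : ℕ) :
    0 ≤ w (j + 1) - w j :=
  sub_nonneg.2 (hw.mono (Nat.le_succ j))

theorem IsSubmodularRule.antitone_increment {w : ℕ → ℝ} (hw : IsSubmodularRule w) :
    Antitone fun j => w (j + 1) - w j :=
  antitone_nat_of_succ_le hw.concave

theorem IsSubmodularRule.le_tangent {w : ℕ → ℝ} (hw : IsSubmodularRule w) (o a : ℕ) :
    w o ≤ w a + ((o : ℝ) - a) * (w (a + 1) - w a) := by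
  rcases le_total a o with h | h
  · induction o, h using Nat.le_induction with
    | base => simp
    | succ m hm ih =>
      have := hw.antitone_increment hm
      simp only at this
      push_cast
      linarith
  · induction a, h using Nat.le_induction with
    | base => simp
    | succ m hm ih =>
      have h1 := hw.concave m
      have h2 : (o : ℝ) ≤ m := by exact_mod_cast hm
      push_cast
      nlinarith [mul_nonneg (by linarith : (0 : ℝ) ≤ (m : ℝ) + 1 - o) (sub_nonneg.2 h1)]

theorem IsSubmodularRule.le_mul {w : ℕ → ℝ} (hw : IsSubmodularRule w) (j : ℕ) :
    w j ≤ j * w 1 := by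
  simpa [hw.map_zero] using hw.le_tangent j 0

variable {𝒲 : Set (ℕ → ℝ)}

/-- The distribution rule of a welfare rule: `Γ.marginal w j` is what an agent gains from
using a resource with rule `w` which `j` other agents use. -/
def UtilityDesign.marginal (Γ : UtilityDesign 𝒲) (w : 𝒲) (j : ℕ) : ℝ :=
  Γ.rule w (j + 1) - Γ.rule w j

namespace UtilityDesign

theorem marginal_nonneg (Γ : UtilityDesign 𝒲) (w : 𝒲) (j : ℕ) : 0 ≤ Γ.marginal w j :=
  (Γ.isRule w).increment_nonneg j

theorem antitone_marginal (Γ : UtilityDesign 𝒲) (w : 𝒲) : Antitone (Γ.marginal w) :=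
  (Γ.isRule w).antitone_increment

theorem sum_marginal (Γ : UtilityDesign 𝒲) (w : 𝒲) (n : ℕ) :
    ∑ j ∈ Finset.range n, Γ.marginal w j = Γ.rule w n := by
  simp only [marginal, Finset.sum_range_sub, (Γ.isRule w).map_zero, sub_zero]

theorem marginal_zero (Γ : UtilityDesign 𝒲) (w : 𝒲) : Γ.marginal w 0 = (w : ℕ → ℝ) 1 := by
  simp [marginal, (Γ.isRule w).map_zero, Γ.rule_one]

theorem mul_marginal_pred_le_rule (Γ : UtilityDesign 𝒲) (w : 𝒲) (a : ℕ) :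
    a * Γ.marginal w (a - 1) ≤ Γ.rule w a := by
  rw [← sum_marginal, ← nsmul_eq_mul]
  calc a • Γ.marginal w (a - 1) = ∑ j ∈ Finset.range a, Γ.marginal w (a - 1) := by simp
    _ ≤ _ := Finset.sum_le_sum fun j hj => Γ.antitone_marginal w (by
        have := Finset.mem_range.1 hj; omega)

end UtilityDesign

namespace Game

variable (G : Game 𝒲) (Γ : UtilityDesign 𝒲)

theorem load_update (b : G.Allocation) (i : Fin G.n) (s : Finset (Fin G.d)) (r : Fin G.d) :
    G.load (Function.update b i s) r =
      G.load (Function.update b i ∅) r + if r ∈ s then 1 else 0 := by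
  simp only [load, Finset.card_filter]
  rw [← Finset.add_sum_erase _ _ (Finset.mem_univ i),
    ← Finset.add_sum_erase (a := i) _ _ (Finset.mem_univ i), add_comm]
  simp only [Function.update_self, Finset.notMem_empty, if_false, zero_add]
  congr 1
  refine Finset.sum_congr rfl fun j hj => ?_
  rw [Function.update_of_ne (Finset.ne_of_mem_erase hj),
    Function.update_of_ne (Finset.ne_of_mem_erase hj)]

theorem utility_update (b : G.Allocation) (i : Fin G.n) (s : Finset (Fin G.d)) :
    G.utility Γ (Function.update b i s) = G.utility Γ (Function.update b i ∅) +
      ∑ r ∈ s, Γ.marginal (G.welfareRule r) (G.load (Function.update b i ∅) r) := by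
  classical
  simp only [utility]
  rw [← Finset.sum_filter_add_sum_filter_not Finset.univ (· ∈ s),
    ← Finset.sum_filter_add_sum_filter_not (s := Finset.univ) (p := (· ∈ s))
      (f := fun r => Γ.rule (G.welfareRule r) (G.load (Function.update b i ∅) r))]
  have hs : Finset.univ.filter (· ∈ s) = s := by ext; simp
  rw [hs, add_right_comm, ← Finset.sum_add_distrib]
  congr 1
  · refine Finset.sum_congr rfl fun r hr => ?_
    rw [load_update, if_pos hr, UtilityDesign.marginal]; ring
  · refine Finset.sum_congr rfl fun r hr => ?_
    rw [load_update, if_neg (Finset.mem_filter.1 hr).2, add_zero]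

theorem mem_bestResponses_iff (b : G.Allocation) (i : Fin G.n) (s : Finset (Fin G.d)) :
    s ∈ G.bestResponses Γ i b ↔ s ∈ G.actions i ∧ ∀ s' ∈ G.actions i,
      ∑ r ∈ s', Γ.marginal (G.welfareRule r) (G.load (Function.update b i ∅) r) ≤
      ∑ r ∈ s, Γ.marginal (G.welfareRule r) (G.load (Function.update b i ∅) r) := by
  refine and_congr_right fun _ => forall₂_congr fun s' _ => ?_
  rw [G.utility_update Γ b i s', G.utility_update Γ b i s, add_le_add_iff_left]

theorem bestResponses_nonempty (i : Fin G.n) (b : G.Allocation) :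
    (G.bestResponses Γ i b).Nonempty := by
  obtain ⟨s, hs, h⟩ := Finset.exists_max_image (G.actions i)
    (fun s => G.utility Γ (Function.update b i s)) (G.actions_nonempty i)
  exact ⟨s, hs, h⟩

theorem n_pos : 0 < G.n := by
  obtain ⟨i, -⟩ := G.nontrivial
  exact i.pos

theorem jointActions_nonempty : G.jointActions.Nonempty :=
  ⟨fun i => (G.actions_nonempty i).choose, fun i => (G.actions_nonempty i).choose_spec⟩

/-! ### Existence of walks that converge -/

open Classical in
/-- A best response of agent `i` that is its current set whenever possible. -/
noncomputable def lazyResponse (b : G.Allocation) (i : Fin G.n) : Finset (Fin G.d) :=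
  if b i ∈ G.bestResponses Γ i b then b i else (G.bestResponses_nonempty Γ i b).some

theorem lazyResponse_mem (b : G.Allocation) (i : Fin G.n) :
    G.lazyResponse Γ b i ∈ G.bestResponses Γ i b := by
  unfold lazyResponse
  split_ifs with h
  · exact h
  · exact Set.Nonempty.some_mem _

/-- The walk from `b` in which every agent moves only if its current set is no best response. -/
noncomputable def lazyWalk (b : G.Allocation) : ℕ → G.Allocation
  | 0 => b
  | t + 1 => fun i =>
      if (i : ℕ) = t % G.n then G.lazyResponse Γ (lazyWalk b t) i else lazyWalk b t i

theorem lazyWalk_step (b : G.Allocation) (t : ℕ) (i : Fin G.n) :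
    ((i : ℕ) = t % G.n →
      G.lazyWalk Γ b (t + 1) i ∈ G.bestResponses Γ i (G.lazyWalk Γ b t)) ∧
    ((i : ℕ) ≠ t % G.n → G.lazyWalk Γ b (t + 1) i = G.lazyWalk Γ b t i) := by
  refine ⟨fun h => ?_, fun h => ?_⟩
  · simp only [lazyWalk, if_pos h]
    exact G.lazyResponse_mem Γ _ i
  · simp only [lazyWalk, if_neg h]

theorem isWalk_lazyWalk : G.IsWalk Γ (G.lazyWalk Γ fun _ => ∅) :=
  ⟨fun _ => rfl, G.lazyWalk_step Γ _⟩

variable {G Γ}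

theorem IsWalk.step_eq_update {a : ℕ → G.Allocation} (ha : G.IsWalk Γ a) (t : ℕ) (i : Fin G.n)
    (hi : (i : ℕ) = t % G.n) : a (t + 1) = Function.update (a t) i (a (t + 1) i) := by
  funext j
  by_cases hj : j = i
  · subst hj; simp
  · rw [Function.update_of_ne hj]
    exact (ha.2 t j).2 fun h => hj (Fin.ext (h.trans hi.symm))

/-- Within a round, the agents move one after the other, each of them once. -/
theorem IsWalk.within_round {a : ℕ → G.Allocation} (ha : G.IsWalk Γ a) (k m : ℕ) (hm : m ≤ G.n)
    (j : Fin G.n) :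
    a (k * G.n + m) j = if (j : ℕ) < m then a ((k + 1) * G.n) j else a (k * G.n) j := by
  have stay : ∀ m, m < G.n → (j : ℕ) ≠ m → a (k * G.n + (m + 1)) j = a (k * G.n + m) j := by
    intro m hm hj
    refine (ha.2 (k * G.n + m) j).2 ?_
    rwa [Nat.mul_comm, Nat.mul_add_mod, Nat.mod_eq_of_lt hm]
  have before : ∀ m, m ≤ (j : ℕ) → a (k * G.n + m) j = a (k * G.n) j := by
    intro m
    induction m with
    | zero => simp
    | succ m ih => exact fun h => (stay m (by omega) (by omega)).trans (ih (by omega))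
  have after : ∀ m', m ≤ m' → m' ≤ G.n → (j : ℕ) < m → a (k * G.n + m') j = a (k * G.n + m) j := by
    intro m' h
    induction m', h using Nat.le_induction with
    | base => exact fun _ _ => rfl
    | succ m' h ih => exact fun h1 h2 => (stay m' (by omega) (by omega)).trans (ih (by omega) h2)
  split_ifs with h
  · rw [add_mul, one_mul, after G.n hm le_rfl h]
  · exact before m (by omega)

theorem IsWalk.mem_actions {a : ℕ → G.Allocation} (ha : G.IsWalk Γ a) (t : ℕ) (ht : G.n ≤ t)
    (i : Fin G.n) : a t i ∈ G.actions i := by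
  induction t, ht using Nat.le_induction with
  | base =>
    have h1 := ha.within_round 0 (i + 1) i.2 i
    have h2 := (ha.2 i i).1 (Nat.mod_eq_of_lt i.2).symm
    simp only [zero_mul, zero_add, one_mul, Nat.lt_succ_self, if_true] at h1
    exact h1 ▸ h2.1
  | succ t ht ih =>
    by_cases h : (i : ℕ) = t % G.n
    · exact ((ha.2 t i).1 h).1
    · rw [(ha.2 t i).2 h]; exact ih

variable (G Γ)

/-- The utility is a potential: it cannot increase forever, and once it does not, a lazy walk
stands still. -/
theorem limitOutcomes_nonempty : (G.limitOutcomes Γ).Nonempty := by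
  classical
  set a := G.lazyWalk Γ fun _ => ∅ with ha_def
  have ha : G.IsWalk Γ a := G.isWalk_lazyWalk Γ
  obtain ⟨t₀, ht₀, hmax⟩ : ∃ t₀, G.n ≤ t₀ ∧ ∀ t, G.n ≤ t →
      G.utility Γ (a t) ≤ G.utility Γ (a t₀) := by
    obtain ⟨b, ⟨t₀, ht₀, rfl⟩, hb⟩ := Set.exists_max_image (a '' Set.Ici G.n) (G.utility Γ)
      (Set.toFinite _) ⟨_, G.n, Set.mem_Ici.2 le_rfl, rfl⟩
    exact ⟨t₀, ht₀, fun t ht => hb _ ⟨t, ht, rfl⟩⟩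
  -- From the time `t₀` of the largest utility on, no agent has an improvement.
  have hconst : ∀ t, t₀ ≤ t → a t = a t₀ := by
    intro t ht
    induction t, ht using Nat.le_induction with
    | base => rfl
    | succ t ht ih =>
      rw [← ih]
      funext i
      by_cases hi : (i : ℕ) = t % G.n
      · have hbr : a t i ∈ G.bestResponses Γ i (a t) := by
          refine ⟨ha.mem_actions t (ht₀.trans ht) i, fun s' hs' => ?_⟩
          have h1 := ((ha.2 t i).1 hi).2 s' hs'
          rw [← ha.step_eq_update t i hi] at h1
          rw [Function.update_eq_self]
          refine le_of_le_of_eq ?_ (congrArg _ ih.symm)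
          exact h1.trans (hmax _ (by omega))
        have h1 : a (t + 1) i = G.lazyResponse Γ (a t) i := if_pos hi
        rw [h1, lazyResponse, if_pos hbr]
      · exact (ha.2 t i).2 hi
  refine ⟨a t₀, a, ha, ?_⟩
  filter_upwards [eventually_ge_atTop t₀] with k hk
  exact hconst _ (hk.trans (Nat.le_mul_of_pos_right k G.n_pos))

theorem outcomes_nonempty (k : ℕ) : (G.outcomes Γ k).Nonempty :=
  ⟨_, _, G.isWalk_lazyWalk Γ, rfl⟩

end Game

namespace Game

variable (G : Game 𝒲) (Γ : UtilityDesign 𝒲)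

/-! ### Efficiency ratios -/

theorem sum_sum_eq_sum_load (o : G.Allocation) (g : Fin G.d → ℝ) :
    ∑ i, ∑ r ∈ o i, g r = ∑ r, G.load o r * g r := by
  have h : ∀ i, ∑ r ∈ o i, g r = ∑ r, if r ∈ o i then g r else 0 := fun i => by simp
  simp only [h]
  rw [Finset.sum_comm]
  refine Finset.sum_congr rfl fun r _ => ?_
  rw [← Finset.sum_filter, Finset.sum_const, nsmul_eq_mul, load]

theorem welfare_nonneg (h𝒲 : ∀ w ∈ 𝒲, IsSubmodularRule w) (a : G.Allocation) :
    0 ≤ G.welfare a :=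
  Finset.sum_nonneg fun r _ => (h𝒲 _ (G.welfareRule r).2).nonneg _

theorem bddBelow_welfare (h𝒲 : ∀ w ∈ 𝒲, IsSubmodularRule w) (S : Set G.Allocation) :
    BddBelow (G.welfare '' S) :=
  ⟨0, by rintro _ ⟨a, -, rfl⟩; exact G.welfare_nonneg h𝒲 a⟩

theorem welfare_le_optWelfare {a : G.Allocation} (ha : a ∈ G.jointActions) :
    G.welfare a ≤ G.optWelfare :=
  le_csSup ((Set.toFinite _).image _).bddAbove ⟨a, ha, rfl⟩

theorem exists_optimal : ∃ o ∈ G.jointActions, G.welfare o = G.optWelfare := by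
  have h := (G.jointActions_nonempty.image G.welfare).csSup_mem ((Set.toFinite _).image _)
  exact h

theorem optWelfare_pos (h𝒲 : ∀ w ∈ 𝒲, IsSubmodularRule w) : 0 < G.optWelfare := by
  obtain ⟨i, s, hs, r, hr⟩ := G.nontrivial
  obtain ⟨b, hb⟩ := G.jointActions_nonempty
  have hmem : Function.update b i s ∈ G.jointActions := by
    intro j
    by_cases hj : j = i
    · subst hj; simpa using hs
    · rw [Function.update_of_ne hj]; exact hb j
  refine lt_of_lt_of_le ?_ (G.welfare_le_optWelfare hmem)
  refine Finset.sum_pos' (fun r _ => (h𝒲 _ (G.welfareRule r).2).nonneg _) ⟨r, Finset.mem_univ _, ?_⟩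
  refine (h𝒲 _ (G.welfareRule r).2).pos _ (Finset.card_pos.2 ⟨i, ?_⟩)
  simpa using hr

/-- The efficiency ratio of a set of possible results is at least `ρ` if each of them
has at least the welfare `ρ * optWelfare`. -/
theorem le_ratio (h𝒲 : ∀ w ∈ 𝒲, IsSubmodularRule w) {S : Set G.Allocation} (hS : S.Nonempty)
    {ρ : ℝ} (h : ∀ α ∈ S, ∀ o ∈ G.jointActions, ρ * G.welfare o ≤ G.welfare α) :
    ρ ≤ sInf (G.welfare '' S) / G.optWelfare := by
  rw [le_div_iff₀ (G.optWelfare_pos h𝒲)]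
  refine le_csInf (hS.image _) ?_
  rintro _ ⟨α, hα, rfl⟩
  obtain ⟨o, ho, ho'⟩ := G.exists_optimal
  exact ho' ▸ h α hα o ho

theorem ratio_nonneg (h𝒲 : ∀ w ∈ 𝒲, IsSubmodularRule w) (S : Set G.Allocation) :
    0 ≤ sInf (G.welfare '' S) / G.optWelfare := by
  refine div_nonneg (Real.sInf_nonneg ?_) (G.optWelfare_pos h𝒲).le
  rintro _ ⟨a, -, rfl⟩
  exact G.welfare_nonneg h𝒲 a

theorem ratio_mul_le (h𝒲 : ∀ w ∈ 𝒲, IsSubmodularRule w) {S : Set G.Allocation}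
    {α o : G.Allocation} (hα : α ∈ S) (ho : o ∈ G.jointActions) :
    sInf (G.welfare '' S) / G.optWelfare * G.welfare o ≤ G.welfare α := by
  have h1 : sInf (G.welfare '' S) ≤ G.welfare α :=
    csInf_le (G.bddBelow_welfare h𝒲 S) ⟨α, hα, rfl⟩
  have h0 := G.optWelfare_pos h𝒲
  calc _ ≤ sInf (G.welfare '' S) / G.optWelfare * G.optWelfare :=
        mul_le_mul_of_nonneg_left (G.welfare_le_optWelfare ho) (G.ratio_nonneg h𝒲 S)
    _ = sInf (G.welfare '' S) := div_mul_cancel₀ _ h0.ne'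
    _ ≤ _ := h1

/-! ### Inequalities satisfied by the results of walks -/

theorem load_eq_add (α : G.Allocation) (i : Fin G.n) (r : Fin G.d) :
    G.load α r = G.load (Function.update α i ∅) r + if r ∈ α i then 1 else 0 := by
  rw [← G.load_update α i (α i) r, Function.update_eq_self]

variable {G Γ}

/-- After one round, every agent `i` has gained at least what it would have gained from `o i`, and
this is at least what the resources in `o i` offer to an additional agent at the end. -/
theorem sum_mul_marginal_le_of_mem_outcomes_one {α o : G.Allocation} (hα : α ∈ G.outcomes Γ 1)
    (ho : o ∈ G.jointActions) :
    ∑ r, G.load o r * Γ.marginal (G.welfareRule r) (G.load α r) ≤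
      ∑ r, Γ.rule (G.welfareRule r) (G.load α r) := by
  obtain ⟨a, ha, rfl⟩ := hα
  rw [one_mul]
  have hstep : ∀ i : Fin G.n, ∑ r ∈ o i, Γ.marginal (G.welfareRule r) (G.load (a G.n) r) ≤
      G.utility Γ (a (i + 1)) - G.utility Γ (a i) := by
    intro i
    have hi : (i : ℕ) = i % G.n := (Nat.mod_eq_of_lt i.2).symm
    have hempty : a i i = ∅ := by
      have := ha.within_round 0 i i.2.le i
      simpa [ha.1] using this
    have hupd : Function.update (a i) i ∅ = a i := by
      rw [← hempty, Function.update_eq_self]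
    have h1 := ((ha.2 i i).1 hi).2 _ (ho i)
    rw [← ha.step_eq_update i i hi, utility_update, hupd] at h1
    refine le_trans (Finset.sum_le_sum fun r _ => ?_) (le_sub_iff_add_le'.2 h1)
    refine Γ.antitone_marginal _ (Finset.card_le_card fun j hj => ?_)
    have hj' := (Finset.mem_filter.1 hj).2
    have h2 := ha.within_round 0 i i.2.le j
    simp only [zero_mul, zero_add, one_mul, ha.1] at h2
    rw [h2] at hj'
    split_ifs at hj' with hlt
    · exact Finset.mem_filter.2 ⟨Finset.mem_univ _, hj'⟩
    · simp at hj'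
  have h0 : G.utility Γ (a 0) = 0 := by
    refine Finset.sum_eq_zero fun r _ => ?_
    have : G.load (a 0) r = 0 := by simp [load, ha.1]
    rw [this, (Γ.isRule _).map_zero]
  calc _ = ∑ i, ∑ r ∈ o i, Γ.marginal (G.welfareRule r) (G.load (a G.n) r) :=
        (G.sum_sum_eq_sum_load o _).symm
    _ ≤ ∑ i : Fin G.n, (G.utility Γ (a (i + 1)) - G.utility Γ (a i)) :=
        Finset.sum_le_sum fun i _ => hstep i
    _ = ∑ i ∈ Finset.range G.n, (G.utility Γ (a (i + 1)) - G.utility Γ (a i)) :=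
        Fin.sum_univ_eq_sum_range (fun i => G.utility Γ (a (i + 1)) - G.utility Γ (a i)) _
    _ = _ := by rw [Finset.sum_range_sub (fun i => G.utility Γ (a i)), h0, sub_zero]; rfl

/-- The limits of walks are Nash equilibria. -/
theorem mem_bestResponses_of_mem_limitOutcomes {α : G.Allocation} (hα : α ∈ G.limitOutcomes Γ)
    (i : Fin G.n) : α i ∈ G.bestResponses Γ i α := by
  obtain ⟨a, ha, hlim⟩ := hα
  obtain ⟨k, hk⟩ := eventually_atTop.1 hlim
  have hconst : ∀ m ≤ G.n, a (k * G.n + m) = α := by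
    intro m hm
    funext j
    rw [ha.within_round k m hm j, hk k le_rfl, hk (k + 1) (by omega), ite_self]
  have h1 := (ha.2 (k * G.n + i) i).1 (by
    rw [Nat.mul_comm, Nat.mul_add_mod, Nat.mod_eq_of_lt i.2])
  rwa [add_assoc, hconst _ i.2, hconst _ i.2.le] at h1

/-- The equilibrium conditions, summed over all agents. -/
theorem sum_mul_marginal_le_of_mem_limitOutcomes {α o : G.Allocation}
    (hα : α ∈ G.limitOutcomes Γ) (ho : o ∈ G.jointActions) :
    ∑ r, G.load o r * Γ.marginal (G.welfareRule r) (G.load α r) ≤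
      ∑ r, G.load α r * Γ.marginal (G.welfareRule r) (G.load α r - 1) := by
  rw [← sum_sum_eq_sum_load, ← sum_sum_eq_sum_load]
  refine Finset.sum_le_sum fun i _ => ?_
  have h := ((mem_bestResponses_iff G Γ α i (α i)).1
    (mem_bestResponses_of_mem_limitOutcomes hα i)).2 _ (ho i)
  refine le_trans (Finset.sum_le_sum fun r _ => ?_) (h.trans (Finset.sum_le_sum fun r hr => ?_))
  · exact Γ.antitone_marginal _ (by rw [G.load_eq_add α i r]; omega)
  · exact Γ.antitone_marginal _ (by rw [G.load_eq_add α i r, if_pos hr]; omega)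

end Game

/-! ### Lower bounds on the guarantees of a design -/

/-- One agent that has to use the single resource. -/
theorem nonempty_game (h : 𝒲.Nonempty) : Nonempty (Game 𝒲) :=
  ⟨{ n := 1
     d := 1
     welfareRule := fun _ => ⟨h.some, h.some_mem⟩
     actions := fun _ => {Finset.univ}
     actions_nonempty := fun _ => by simp
     nontrivial := ⟨0, Finset.univ, by simp, by simp⟩ }⟩

namespace UtilityDesign

variable (Γ : UtilityDesign 𝒲)

theorem efficiency_nonneg (h𝒲 : ∀ w ∈ 𝒲, IsSubmodularRule w) (k : ℕ) : 0 ≤ Γ.efficiency k :=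
  Real.iInf_nonneg fun G => G.ratio_nonneg h𝒲 _

theorem asymptoticEfficiency_nonneg (h𝒲 : ∀ w ∈ 𝒲, IsSubmodularRule w) :
    0 ≤ Γ.asymptoticEfficiency :=
  Real.iInf_nonneg fun G => G.ratio_nonneg h𝒲 _

theorem efficiency_le (h𝒲 : ∀ w ∈ 𝒲, IsSubmodularRule w) (k : ℕ) (G : Game 𝒲) :
    Γ.efficiency k ≤ G.efficiency Γ k :=
  ciInf_le ⟨0, by rintro _ ⟨G, rfl⟩; exact G.ratio_nonneg h𝒲 _⟩ G

theorem asymptoticEfficiency_le (h𝒲 : ∀ w ∈ 𝒲, IsSubmodularRule w) (G : Game 𝒲) :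
    Γ.asymptoticEfficiency ≤ G.asymptoticEfficiency Γ :=
  ciInf_le ⟨0, by rintro _ ⟨G, rfl⟩; exact G.ratio_nonneg h𝒲 _⟩ G

/-- A smoothness criterion for one round. -/
theorem le_efficiency_one (h𝒲 : ∀ w ∈ 𝒲, IsSubmodularRule w) (hne : 𝒲.Nonempty) {ρ : ℝ}
    (hρ : 0 ≤ ρ) (h : ∀ (w : 𝒲) (o a : ℕ), ρ * (w : ℕ → ℝ) o ≤
      ρ * (o * Γ.marginal w a - Γ.rule w a) + (w : ℕ → ℝ) a) : ρ ≤ Γ.efficiency 1 := by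
  have := nonempty_game hne
  refine le_ciInf fun G => G.le_ratio h𝒲 (G.outcomes_nonempty Γ 1) fun α hα o ho => ?_
  have h1 := mul_le_mul_of_nonneg_left (Game.sum_mul_marginal_le_of_mem_outcomes_one hα ho) hρ
  have h2 := Finset.sum_le_sum fun r (_ : r ∈ Finset.univ) =>
    h (G.welfareRule r) (G.load o r) (G.load α r)
  rw [← Finset.mul_sum, Finset.sum_add_distrib, ← Finset.mul_sum, Finset.sum_sub_distrib] at h2
  unfold Game.welfare
  linarith

/-- A smoothness criterion for equilibria. -/
theorem le_asymptoticEfficiency (h𝒲 : ∀ w ∈ 𝒲, IsSubmodularRule w) (hne : 𝒲.Nonempty) {ρ : ℝ}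
    (hρ : 0 ≤ ρ) (h : ∀ (w : 𝒲) (o a : ℕ), ρ * (w : ℕ → ℝ) o ≤
      ρ * (o * Γ.marginal w a - a * Γ.marginal w (a - 1)) + (w : ℕ → ℝ) a) :
    ρ ≤ Γ.asymptoticEfficiency := by
  have := nonempty_game hne
  refine le_ciInf fun G => G.le_ratio h𝒲 (G.limitOutcomes_nonempty Γ) fun α hα o ho => ?_
  have h1 := mul_le_mul_of_nonneg_left (Game.sum_mul_marginal_le_of_mem_limitOutcomes hα ho) hρ
  have h2 := Finset.sum_le_sum fun r (_ : r ∈ Finset.univ) =>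
    h (G.welfareRule r) (G.load o r) (G.load α r)
  rw [← Finset.mul_sum, Finset.sum_add_distrib, ← Finset.mul_sum, Finset.sum_sub_distrib] at h2
  unfold Game.welfare
  linarith

end UtilityDesign

/-! ### Walks in which every agent moves only once -/

namespace Game

variable {G : Game 𝒲} {Γ : UtilityDesign 𝒲}

/-- The allocation in which the agents numbered less than `t` use their sets in `a`, and the
other agents use nothing. -/
def firstMovers (a : G.Allocation) (t : ℕ) : G.Allocation :=
  fun i => if (i : ℕ) < t then a i else ∅

theorem firstMovers_of_le (a : G.Allocation) {t : ℕ} (ht : G.n ≤ t) : firstMovers a t = a := by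
  funext j
  exact if_pos (j.2.trans_le ht)

theorem firstMovers_zero (a : G.Allocation) (i : Fin G.n) : firstMovers a 0 i = ∅ :=
  if_neg (Nat.not_lt_zero _)

theorem firstMovers_step {a : G.Allocation}
    (h₁ : ∀ i : Fin G.n, a i ∈ G.bestResponses Γ i (firstMovers a i)) (t : ℕ) (ht : t < G.n)
    (i : Fin G.n) :
    ((i : ℕ) = t % G.n → firstMovers a (t + 1) i ∈ G.bestResponses Γ i (firstMovers a t)) ∧
    ((i : ℕ) ≠ t % G.n → firstMovers a (t + 1) i = firstMovers a t i) := by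
  rw [Nat.mod_eq_of_lt ht]
  refine ⟨fun hi => ?_, fun hi => ?_⟩
  · have h2 : firstMovers a (t + 1) i = a i := if_pos (by omega)
    rw [h2, ← hi]
    exact h₁ i
  · have h3 : (i : ℕ) < t + 1 ↔ (i : ℕ) < t := by omega
    simp only [firstMovers, h3]

theorem mem_outcomes_one {a : G.Allocation}
    (h₁ : ∀ i : Fin G.n, a i ∈ G.bestResponses Γ i (firstMovers a i)) : a ∈ G.outcomes Γ 1 := by
  refine ⟨fun t => if t < G.n then firstMovers a t else G.lazyWalk Γ a (t - G.n),
    ⟨fun i => ?_, fun t i => ?_⟩, ?_⟩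
  · simp only [G.n_pos, if_true, firstMovers_zero]
  · rcases lt_or_ge t G.n with ht | ht
    · have h4 : (if t + 1 < G.n then firstMovers a (t + 1) else
          G.lazyWalk Γ a (t + 1 - G.n)) = firstMovers a (t + 1) := by
        split_ifs with h5
        · rfl
        · rw [firstMovers_of_le a (by omega), show t + 1 - G.n = 0 by omega]; rfl
      simp only [h4, if_pos ht]
      exact firstMovers_step h₁ t ht i
    · obtain ⟨k, rfl⟩ := Nat.exists_eq_add_of_le ht
      simp only [not_lt.2 ht, not_lt.2 (show G.n ≤ G.n + k + 1 by omega), if_false,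
        show G.n + k + 1 - G.n = k + 1 by omega, show G.n + k - G.n = k by omega,
        Nat.add_mod_left]
      exact G.lazyWalk_step Γ a k i
  · simp [lazyWalk]

theorem mem_limitOutcomes {a : G.Allocation}
    (h₁ : ∀ i : Fin G.n, a i ∈ G.bestResponses Γ i (firstMovers a i))
    (h₂ : ∀ i : Fin G.n, a i ∈ G.bestResponses Γ i a) : a ∈ G.limitOutcomes Γ := by
  refine ⟨firstMovers a, ⟨firstMovers_zero a, fun t i => ?_⟩, ?_⟩
  · rcases lt_or_ge t G.n with ht | ht
    · exact firstMovers_step h₁ t ht i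
    · rw [firstMovers_of_le a ht, firstMovers_of_le a (ht.trans (Nat.le_succ t))]
      exact ⟨fun _ => h₂ i, fun _ => rfl⟩
  · filter_upwards [eventually_ge_atTop 1] with k hk
    exact firstMovers_of_le a (Nat.le_mul_of_pos_left G.n hk)

end Game

/-! ### Games with two actions for each agent -/

section PairGame

variable {T d : ℕ}

/-- The game in which agent `i` chooses between the sets `a i` and `o i`. -/
abbrev pairGame (w : Fin d → 𝒲) (a o : Fin T → Finset (Fin d)) (h : ∃ i, (o i).Nonempty) :
    Game 𝒲 where
  n := T
  d := d
  welfareRule := w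
  actions i := {a i, o i}
  actions_nonempty i := by simp
  nontrivial := h.imp fun i hi => ⟨o i, by simp, hi⟩

theorem mem_bestResponses_pairGame {w : Fin d → 𝒲} {a o : Fin T → Finset (Fin d)}
    {h : ∃ i, (o i).Nonempty} {Γ : UtilityDesign 𝒲} (b : Fin T → Finset (Fin d)) (i : Fin T)
    (hi : ∑ r ∈ o i, Γ.marginal (w r) (Finset.univ.filter fun j => j ≠ i ∧ r ∈ b j).card ≤
      ∑ r ∈ a i, Γ.marginal (w r) (Finset.univ.filter fun j => j ≠ i ∧ r ∈ b j).card) :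
    a i ∈ (pairGame w a o h).bestResponses Γ i b := by
  have h1 : ∀ r, (pairGame w a o h).load (Function.update b i ∅) r =
      (Finset.univ.filter fun j => j ≠ i ∧ r ∈ b j).card := by
    intro r
    refine congrArg Finset.card (Finset.filter_congr fun j _ => ?_)
    by_cases hj : j = i
    · subst hj; simp
    · simp [hj]
  refine ((pairGame w a o h).mem_bestResponses_iff Γ b i (a i)).2 ⟨by simp, fun s' hs' => ?_⟩
  simp only [h1]
  rcases Finset.mem_insert.1 hs' with rfl | hs'
  · exact le_rfl
  · rw [Finset.mem_singleton.1 hs']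
    exact hi

theorem mem_bestResponses_pairGame_firstMovers {w : Fin d → 𝒲} {a o : Fin T → Finset (Fin d)}
    {h : ∃ i, (o i).Nonempty} {Γ : UtilityDesign 𝒲} (i : Fin T)
    (hi : ∑ r ∈ o i, Γ.marginal (w r) (Finset.univ.filter fun j => j < i ∧ r ∈ a j).card ≤
      ∑ r ∈ a i, Γ.marginal (w r) (Finset.univ.filter fun j => j < i ∧ r ∈ a j).card) :
    a i ∈ (pairGame w a o h).bestResponses Γ i
      (Game.firstMovers (G := pairGame w a o h) a i) := by
  refine mem_bestResponses_pairGame _ i ?_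
  have h3 : ∀ r, (Finset.univ.filter fun j =>
      j ≠ i ∧ r ∈ Game.firstMovers (G := pairGame w a o h) a i j) =
      Finset.univ.filter fun j => j < i ∧ r ∈ a j := by
    intro r
    refine Finset.filter_congr fun j _ => ?_
    simp only [Game.firstMovers]
    split_ifs with hj
    · exact ⟨fun h => ⟨hj, h.2⟩, fun h => ⟨h.1.ne, h.2⟩⟩
    · simp only [Finset.notMem_empty, and_false, false_iff, not_and]
      exact fun h => absurd h hj
  simpa only [h3] using hi

/-- If all `o i` are empty, then `pairGame` is not defined, but there is nothing to prove. -/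
theorem welfare_comparison_of_pairGame (h𝒲 : ∀ w ∈ 𝒲, IsSubmodularRule w) (w : Fin d → 𝒲)
    (a o : Fin T → Finset (Fin d)) {ρ : ℝ}
    (H : ∀ h : ∃ i, (o i).Nonempty,
      ρ * (pairGame w a o h).welfare o ≤ (pairGame w a o h).welfare a) :
    ρ * ∑ r, (w r : ℕ → ℝ) (Finset.univ.filter fun i => r ∈ o i).card ≤
      ∑ r, (w r : ℕ → ℝ) (Finset.univ.filter fun i => r ∈ a i).card := by
  by_cases h : ∃ i, (o i).Nonempty
  · exact H h
  · have h' : ∀ i, o i = ∅ := fun i => Finset.not_nonempty_iff_eq_empty.1 fun hi => h ⟨i, hi⟩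
    have h0 : ∑ r, (w r : ℕ → ℝ) (Finset.univ.filter fun i => r ∈ o i).card = 0 :=
      Finset.sum_eq_zero fun r _ => by simp [h', (h𝒲 _ (w r).2).map_zero]
    rw [h0, mul_zero]
    exact Finset.sum_nonneg fun r _ => (h𝒲 _ (w r).2).nonneg _

theorem right_mem_jointActions (w : Fin d → 𝒲) (a o : Fin T → Finset (Fin d)) (h) :
    o ∈ (pairGame w a o h).jointActions := fun i => by simp

variable {R : Type*} [Fintype R] [DecidableEq R]

/-- If each agent `i` weakly prefers `a i` to `o i` given the choices `a j` of the preceding agents,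
then all agents may choose `a i` in the first round. -/
theorem efficiency_one_mul_le (h𝒲 : ∀ w ∈ 𝒲, IsSubmodularRule w) (Γ : UtilityDesign 𝒲)
    (w : R → 𝒲) (a o : Fin T → Finset R)
    (h₁ : ∀ i, ∑ r ∈ o i, Γ.marginal (w r) (Finset.univ.filter fun j => j < i ∧ r ∈ a j).card ≤
      ∑ r ∈ a i, Γ.marginal (w r) (Finset.univ.filter fun j => j < i ∧ r ∈ a j).card) :
    Γ.efficiency 1 * ∑ r, (w r : ℕ → ℝ) (Finset.univ.filter fun i => r ∈ o i).card ≤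
      ∑ r, (w r : ℕ → ℝ) (Finset.univ.filter fun i => r ∈ a i).card := by
  let e := Fintype.equivFin R
  have key := welfare_comparison_of_pairGame (ρ := Γ.efficiency 1) h𝒲 (w ∘ e.symm)
    (fun i => (a i).map e.toEmbedding) (fun i => (o i).map e.toEmbedding) fun h =>
      (mul_le_mul_of_nonneg_right (Γ.efficiency_le h𝒲 1 _) (Game.welfare_nonneg _ h𝒲 _)).trans
        (Game.ratio_mul_le _ h𝒲 (Game.mem_outcomes_one fun i =>
          mem_bestResponses_pairGame_firstMovers i (by simpa using h₁ i))
        (right_mem_jointActions _ _ _ h))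
  rw [← e.sum_comp, ← e.sum_comp] at key
  simpa using key

/-- If moreover no agent prefers `o i` to `a i` given the choices `a j` of all other agents, then the
walk may stop there. -/
theorem asymptoticEfficiency_mul_le (h𝒲 : ∀ w ∈ 𝒲, IsSubmodularRule w) (Γ : UtilityDesign 𝒲)
    (w : R → 𝒲) (a o : Fin T → Finset R)
    (h₁ : ∀ i, ∑ r ∈ o i, Γ.marginal (w r) (Finset.univ.filter fun j => j < i ∧ r ∈ a j).card ≤
      ∑ r ∈ a i, Γ.marginal (w r) (Finset.univ.filter fun j => j < i ∧ r ∈ a j).card)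
    (h₂ : ∀ i, ∑ r ∈ o i, Γ.marginal (w r) (Finset.univ.filter fun j => j ≠ i ∧ r ∈ a j).card ≤
      ∑ r ∈ a i, Γ.marginal (w r) (Finset.univ.filter fun j => j ≠ i ∧ r ∈ a j).card) :
    Γ.asymptoticEfficiency * ∑ r, (w r : ℕ → ℝ) (Finset.univ.filter fun i => r ∈ o i).card ≤
      ∑ r, (w r : ℕ → ℝ) (Finset.univ.filter fun i => r ∈ a i).card := by
  let e := Fintype.equivFin R
  have key := welfare_comparison_of_pairGame (ρ := Γ.asymptoticEfficiency) h𝒲 (w ∘ e.symm)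
    (fun i => (a i).map e.toEmbedding) (fun i => (o i).map e.toEmbedding) fun h =>
      (mul_le_mul_of_nonneg_right (Γ.asymptoticEfficiency_le h𝒲 _)
        (Game.welfare_nonneg _ h𝒲 _)).trans
        (Game.ratio_mul_le _ h𝒲 (Game.mem_limitOutcomes
          (fun i => mem_bestResponses_pairGame_firstMovers i (by simpa using h₁ i))
          fun i => mem_bestResponses_pairGame _ i (by simpa using h₂ i))
        (right_mem_jointActions _ _ _ h))
  rw [← e.sum_comp, ← e.sum_comp] at key
  simpa using key

end PairGame

/-! ### Chains of overlapping resources -/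

section Chain

theorem card_filter_fin (T lo hi : ℕ) (h : hi ≤ T) :
    (Finset.univ.filter fun j : Fin T => lo ≤ (j : ℕ) ∧ (j : ℕ) < hi).card = hi - lo := by
  rw [← Nat.card_Ico, ← Finset.card_map Fin.valEmbedding]
  congr 1
  ext x
  simp only [Finset.mem_map, Finset.mem_filter, Finset.mem_univ, true_and, Fin.valEmbedding_apply,
    Finset.mem_Ico]
  exact ⟨by rintro ⟨j, hj, rfl⟩; exact hj, fun hx => ⟨⟨x, by omega⟩, hx, rfl⟩⟩

theorem card_filter_fin_le (T lo hi : ℕ) :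
    (Finset.univ.filter fun j : Fin T => lo ≤ (j : ℕ) ∧ (j : ℕ) < hi).card ≤ hi - lo := by
  rcases le_total hi T with h | h
  · exact (card_filter_fin T lo hi h).le
  · refine le_trans (Finset.card_le_card fun j hj => ?_)
      ((card_filter_fin T lo T le_rfl).le.trans (Nat.sub_le_sub_right h lo))
    simp only [Finset.mem_filter] at hj ⊢
    exact ⟨hj.1, hj.2.1, j.2⟩

variable {ι : Type*} [Fintype ι]

/-- Resource `(r, s)` is used by the `a r` agents `s, …, s + a r - 1` (those of them that exist). -/
def chainUsers (a : ι → ℕ) (T : ℕ) (t : Fin T) : Finset (ι × Fin T) :=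
  Finset.univ.filter fun x => (x.2 : ℕ) ≤ t ∧ (t : ℕ) < x.2 + a x.1

/-- Resource `(r, s)` can be used instead by the `o r` agents following the agents of
`chainUsers`, but the agents before `M` have no alternative. -/
def chainAlternatives (a o : ι → ℕ) (M T : ℕ) (t : Fin T) : Finset (ι × Fin T) :=
  Finset.univ.filter fun x => M ≤ (t : ℕ) ∧ (x.2 : ℕ) + a x.1 ≤ t ∧ (t : ℕ) < x.2 + a x.1 + o x.1

theorem sum_chainUsers (a : ι → ℕ) (T : ℕ) (t : Fin T) (ht : ∀ r, a r ≤ t) (g : ι → ℕ → ℝ) :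
    ∑ x ∈ chainUsers a T t, g x.1 (t - x.2) = ∑ r, ∑ m ∈ Finset.range (a r), g r m := by
  rw [chainUsers, Finset.sum_filter, Fintype.sum_prod_type]
  refine Finset.sum_congr rfl fun r _ => ?_
  simp only
  rw [← Finset.sum_filter]
  have htT := t.2
  have har := ht r
  refine Finset.sum_bij (fun s _ => (t : ℕ) - s) ?_ ?_ ?_ (fun _ _ => rfl)
  · intro s hs
    simp only [Finset.mem_filter, Finset.mem_univ, true_and] at hs
    simp only [Finset.mem_range]
    omega
  · intro s hs s' hs' h
    simp only [Finset.mem_filter, Finset.mem_univ, true_and] at hs hs'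
    exact Fin.ext (by omega)
  · intro m hm
    simp only [Finset.mem_range] at hm
    refine ⟨⟨t - m, by omega⟩, ?_, ?_⟩
    · simp only [Finset.mem_filter, Finset.mem_univ, true_and]
      omega
    · simp only
      omega

theorem sum_chainAlternatives_le (a o : ι → ℕ) (M T : ℕ) (t : Fin T) {g : ι → ℝ}
    (hg : ∀ r, 0 ≤ g r) :
    ∑ x ∈ chainAlternatives a o M T t, g x.1 ≤ ∑ r, o r * g r := by
  rw [chainAlternatives, Finset.sum_filter, Fintype.sum_prod_type]
  refine Finset.sum_le_sum fun r _ => ?_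
  simp only
  rw [← Finset.sum_filter, Finset.sum_const, nsmul_eq_mul]
  refine mul_le_mul_of_nonneg_right ?_ (hg r)
  norm_cast
  refine le_trans (Finset.card_le_card fun s hs => ?_)
    ((card_filter_fin_le T (t + 1 - (a r + o r)) (t + 1 - a r)).trans (by omega))
  simp only [Finset.mem_filter, Finset.mem_univ, true_and] at hs ⊢
  omega

variable [DecidableEq ι]

/-- The `N` copies `(r, s)` with `M ≤ s < M + N` of each resource `r` have all their alternative
users, as these are neither among the first `M` agents nor beyond the last one. -/
theorem mul_sum_le_welfare_chainAlternatives (h𝒲 : ∀ w ∈ 𝒲, IsSubmodularRule w) (w : ι → 𝒲)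
    (a o : ι → ℕ) (M N : ℕ) (hM : ∀ r, a r + o r ≤ M) :
    N * ∑ r, (w r : ℕ → ℝ) (o r) ≤ ∑ x : ι × Fin (M + N + M), (w x.1 : ℕ → ℝ)
      (Finset.univ.filter fun i => x ∈ chainAlternatives a o M (M + N + M) i).card := by
  rw [Fintype.sum_prod_type, Finset.mul_sum]
  refine Finset.sum_le_sum fun r _ => ?_
  have hN := card_filter_fin (M + N + M) M (M + N) (by omega)
  calc (N : ℝ) * (w r : ℕ → ℝ) (o r) = ∑ s ∈ Finset.univ.filter fun s : Fin (M + N + M) =>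
        M ≤ (s : ℕ) ∧ (s : ℕ) < M + N, (w r : ℕ → ℝ) (o r) := by
        rw [Finset.sum_const, hN, nsmul_eq_mul]; simp
    _ ≤ ∑ s ∈ Finset.univ.filter fun s : Fin (M + N + M) => M ≤ (s : ℕ) ∧ (s : ℕ) < M + N,
        (w r : ℕ → ℝ) (Finset.univ.filter fun i =>
          (r, s) ∈ chainAlternatives a o M (M + N + M) i).card := by
        refine Finset.sum_le_sum fun s hs => (h𝒲 _ (w r).2).mono ?_
        simp only [Finset.mem_filter, Finset.mem_univ, true_and] at hs
        have := hM r
        have hc := card_filter_fin (M + N + M) (s + a r) (s + a r + o r) (by omega)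
        rw [show o r = (s + a r + o r) - (s + a r) by omega, ← hc]
        refine Finset.card_le_card fun i hi => ?_
        simp only [Finset.mem_filter, Finset.mem_univ, true_and, chainAlternatives] at hi ⊢
        omega
    _ ≤ _ := Finset.sum_le_sum_of_subset_of_nonneg (Finset.filter_subset _ _)
        fun s _ _ => (h𝒲 _ (w r).2).nonneg _

theorem welfare_chainUsers_le (h𝒲 : ∀ w ∈ 𝒲, IsSubmodularRule w) (w : ι → 𝒲) (a : ι → ℕ)
    (T : ℕ) : ∑ x : ι × Fin T, (w x.1 : ℕ → ℝ)
      (Finset.univ.filter fun i => x ∈ chainUsers a T i).card ≤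
      T * ∑ r, (w r : ℕ → ℝ) (a r) := by
  rw [Fintype.sum_prod_type, Finset.mul_sum]
  refine Finset.sum_le_sum fun r _ => ?_
  refine (Finset.sum_le_card_nsmul _ _ ((w r : ℕ → ℝ) (a r)) fun s _ => ?_).trans (by simp)
  refine (h𝒲 _ (w r).2).mono ?_
  have := card_filter_fin_le T s (s + a r)
  simpa [chainUsers] using this

/-- In the first round, an agent finds its alternatives fully used, whereas its own resources of
type `r` have `0, …, a r - 1` users. -/
theorem chain_prefers_first (Γ : UtilityDesign 𝒲) (w : ι → 𝒲) (a o : ι → ℕ) (M T : ℕ)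
    (hM : ∀ r, a r + o r ≤ M)
    (h : ∑ r, o r * Γ.marginal (w r) (a r) ≤ ∑ r, Γ.rule (w r) (a r)) (t : Fin T) :
    ∑ x ∈ chainAlternatives a o M T t, Γ.marginal (w x.1)
        (Finset.univ.filter fun j => j < t ∧ x ∈ chainUsers a T j).card ≤
      ∑ x ∈ chainUsers a T t, Γ.marginal (w x.1)
        (Finset.univ.filter fun j => j < t ∧ x ∈ chainUsers a T j).card := by
  rcases lt_or_ge (t : ℕ) M with ht | ht
  · have h0 : chainAlternatives a o M T t = ∅ := by
      simp [chainAlternatives, not_le.2 ht]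
    rw [h0, Finset.sum_empty]
    exact Finset.sum_nonneg fun x _ => Γ.marginal_nonneg _ _
  have htT := t.2
  have hA : ∀ x ∈ chainAlternatives a o M T t,
      (Finset.univ.filter fun j => j < t ∧ x ∈ chainUsers a T j).card = a x.1 := by
    intro x hx
    simp only [chainAlternatives, Finset.mem_filter, Finset.mem_univ, true_and] at hx
    have := card_filter_fin T x.2 (x.2 + a x.1) (by omega)
    rw [Nat.add_sub_cancel_left] at this
    rw [← this]
    refine congrArg Finset.card (Finset.filter_congr fun j _ => ?_)
    simp only [chainUsers, Finset.mem_filter, Finset.mem_univ, true_and, Fin.lt_def]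
    omega
  have hU : ∀ x ∈ chainUsers a T t,
      (Finset.univ.filter fun j => j < t ∧ x ∈ chainUsers a T j).card = t - x.2 := by
    intro x hx
    simp only [chainUsers, Finset.mem_filter, Finset.mem_univ, true_and] at hx
    rw [← card_filter_fin T x.2 t (by omega)]
    refine congrArg Finset.card (Finset.filter_congr fun j _ => ?_)
    simp only [chainUsers, Finset.mem_filter, Finset.mem_univ, true_and, Fin.lt_def]
    omega
  rw [Finset.sum_congr rfl fun x hx => congrArg (Γ.marginal (w x.1)) (hA x hx),
    Finset.sum_congr rfl fun x hx => congrArg (Γ.marginal (w x.1)) (hU x hx),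
    sum_chainUsers a T t (fun r => by have := hM r; omega) fun r m => Γ.marginal (w r) m]
  simp only [UtilityDesign.sum_marginal]
  exact (sum_chainAlternatives_le a o M T t fun r => Γ.marginal_nonneg (w r) (a r)).trans h

/-- At the end, an agent finds its alternatives fully used, and at most `a r - 1` other users of each
of its own resources of type `r`. -/
theorem chain_prefers_all (Γ : UtilityDesign 𝒲) (w : ι → 𝒲) (a o : ι → ℕ) (M T : ℕ)
    (hM : ∀ r, a r + o r ≤ M)
    (h : ∑ r, o r * Γ.marginal (w r) (a r) ≤ ∑ r, a r * Γ.marginal (w r) (a r - 1))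
    (t : Fin T) :
    ∑ x ∈ chainAlternatives a o M T t, Γ.marginal (w x.1)
        (Finset.univ.filter fun j => j ≠ t ∧ x ∈ chainUsers a T j).card ≤
      ∑ x ∈ chainUsers a T t, Γ.marginal (w x.1)
        (Finset.univ.filter fun j => j ≠ t ∧ x ∈ chainUsers a T j).card := by
  rcases lt_or_ge (t : ℕ) M with ht | ht
  · have h0 : chainAlternatives a o M T t = ∅ := by
      simp [chainAlternatives, not_le.2 ht]
    rw [h0, Finset.sum_empty]
    exact Finset.sum_nonneg fun x _ => Γ.marginal_nonneg _ _
  have htT := t.2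
  have hA : ∀ x ∈ chainAlternatives a o M T t,
      (Finset.univ.filter fun j => j ≠ t ∧ x ∈ chainUsers a T j).card = a x.1 := by
    intro x hx
    simp only [chainAlternatives, Finset.mem_filter, Finset.mem_univ, true_and] at hx
    have := card_filter_fin T x.2 (x.2 + a x.1) (by omega)
    rw [Nat.add_sub_cancel_left] at this
    rw [← this]
    refine congrArg Finset.card (Finset.filter_congr fun j _ => ?_)
    simp only [chainUsers, Finset.mem_filter, Finset.mem_univ, true_and, ne_eq, Fin.ext_iff]
    omega
  have hU : ∀ x ∈ chainUsers a T t,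
      (Finset.univ.filter fun j => j ≠ t ∧ x ∈ chainUsers a T j).card ≤ a x.1 - 1 := by
    intro x hx
    have hle := card_filter_fin_le T x.2 (x.2 + a x.1)
    rw [Nat.add_sub_cancel_left] at hle
    have hmem : t ∈ Finset.univ.filter fun j : Fin T =>
        (x.2 : ℕ) ≤ j ∧ (j : ℕ) < x.2 + a x.1 := by simpa [chainUsers] using hx
    refine le_trans (Finset.card_le_card fun j hj => ?_)
      ((Finset.card_erase_of_mem hmem).le.trans (Nat.sub_le_sub_right hle 1))
    simpa [chainUsers] using hj
  have h1 : ∑ x ∈ chainUsers a T t, Γ.marginal (w x.1) (a x.1 - 1) =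
      ∑ r, a r * Γ.marginal (w r) (a r - 1) := by
    rw [sum_chainUsers a T t (fun r => by have := hM r; omega)
      fun r _ => Γ.marginal (w r) (a r - 1)]
    simp
  rw [Finset.sum_congr rfl fun x hx => congrArg (Γ.marginal (w x.1)) (hA x hx)]
  calc _ ≤ ∑ r, o r * Γ.marginal (w r) (a r) :=
        sum_chainAlternatives_le a o M T t fun r => Γ.marginal_nonneg (w r) (a r)
    _ ≤ ∑ r, a r * Γ.marginal (w r) (a r - 1) := h
    _ = _ := h1.symm
    _ ≤ _ := Finset.sum_le_sum fun x hx => Γ.antitone_marginal _ (hU x hx)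

/-- The boundary effects of a chain vanish as its length `N` grows. -/
theorem le_of_chain_comparison {ρ A B : ℝ} {M : ℕ}
    (h : ∀ N : ℕ, ρ * (N * B) ≤ (M + N + M) * A) : ρ * B ≤ A := by
  by_contra! hlt
  obtain ⟨N, hN⟩ := exists_nat_gt (2 * M * A / (ρ * B - A))
  rw [div_lt_iff₀ (by linarith)] at hN
  linarith [h N]

/-- The guarantee after one round applies to any finite family of resource types, since these can
be arranged in a chain. -/
theorem efficiency_one_mul_sum_le (h𝒲 : ∀ w ∈ 𝒲, IsSubmodularRule w) (Γ : UtilityDesign 𝒲)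
    (w : ι → 𝒲) (a o : ι → ℕ)
    (h : ∑ r, o r * Γ.marginal (w r) (a r) ≤ ∑ r, Γ.rule (w r) (a r)) :
    Γ.efficiency 1 * ∑ r, (w r : ℕ → ℝ) (o r) ≤ ∑ r, (w r : ℕ → ℝ) (a r) := by
  obtain ⟨M, hM⟩ : ∃ M, ∀ r, a r + o r ≤ M :=
    ⟨∑ r, (a r + o r), fun r => Finset.single_le_sum (f := fun r => a r + o r) (fun _ _ => Nat.zero_le _)
      (Finset.mem_univ r)⟩
  refine le_of_chain_comparison (M := M) fun N => ?_
  have h1 := efficiency_one_mul_le h𝒲 Γ (fun x : ι × Fin (M + N + M) => w x.1)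
    (chainUsers a _) (chainAlternatives a o M _)
    (fun t => chain_prefers_first Γ w a o M _ hM h t)
  have h2 := mul_le_mul_of_nonneg_left
    (mul_sum_le_welfare_chainAlternatives h𝒲 w a o M N hM) (Γ.efficiency_nonneg h𝒲 1)
  have h3 := welfare_chainUsers_le h𝒲 w a (M + N + M)
  push_cast at h3
  exact h2.trans (h1.trans h3)

/-- The analogue of `efficiency_one_mul_sum_le` for equilibria. -/
theorem asymptoticEfficiency_mul_sum_le (h𝒲 : ∀ w ∈ 𝒲, IsSubmodularRule w)
    (Γ : UtilityDesign 𝒲) (w : ι → 𝒲) (a o : ι → ℕ)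
    (h : ∑ r, o r * Γ.marginal (w r) (a r) ≤ ∑ r, a r * Γ.marginal (w r) (a r - 1)) :
    Γ.asymptoticEfficiency * ∑ r, (w r : ℕ → ℝ) (o r) ≤ ∑ r, (w r : ℕ → ℝ) (a r) := by
  obtain ⟨M, hM⟩ : ∃ M, ∀ r, a r + o r ≤ M :=
    ⟨∑ r, (a r + o r), fun r => Finset.single_le_sum (f := fun r => a r + o r) (fun _ _ => Nat.zero_le _)
      (Finset.mem_univ r)⟩
  refine le_of_chain_comparison (M := M) fun N => ?_
  have h1 := asymptoticEfficiency_mul_le h𝒲 Γ (fun x : ι × Fin (M + N + M) => w x.1)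
    (chainUsers a _) (chainAlternatives a o M _)
    (fun t => chain_prefers_first Γ w a o M _ hM
      (h.trans (Finset.sum_le_sum fun r _ => Γ.mul_marginal_pred_le_rule (w r) (a r))) t)
    (fun t => chain_prefers_all Γ w a o M _ hM h t)
  have h2 := mul_le_mul_of_nonneg_left
    (mul_sum_le_welfare_chainAlternatives h𝒲 w a o M N hM) (Γ.asymptoticEfficiency_nonneg h𝒲)
  have h3 := welfare_chainUsers_le h𝒲 w a (M + N + M)
  push_cast at h3
  exact h2.trans (h1.trans h3)

end Chain

/-! ### Necessary conditions on designs with good guarantees -/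

section Necessary

/-- The guarantee after one round bounds the distribution rule of each `w`: apart from resources with
rule `w`, alternatives that nobody else uses and that have the marginal value
`Γ(w)(a) - o * Γ.marginal w a` make the agents indifferent. -/
theorem efficiency_one_mul_add_le (h𝒲 : ∀ w ∈ 𝒲, IsSubmodularRule w)
    (h1 : ∀ D : ℝ, 0 < D → ∃ w ∈ 𝒲, w 1 = D) (Γ : UtilityDesign 𝒲) (w : 𝒲) (a o : ℕ)
    (hD : 0 ≤ Γ.rule w a - o * Γ.marginal w a) :
    Γ.efficiency 1 * ((w : ℕ → ℝ) o + (Γ.rule w a - o * Γ.marginal w a)) ≤ (w : ℕ → ℝ) a := by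
  rcases hD.eq_or_lt with hD | hD
  · have := efficiency_one_mul_sum_le h𝒲 Γ (fun _ : Unit => w) (fun _ => a) (fun _ => o)
      (by simpa using sub_nonneg.1 hD.le)
    rw [← hD, add_zero]
    simpa using this
  · obtain ⟨v, hv, hv1⟩ := h1 _ hD
    have := efficiency_one_mul_sum_le h𝒲 Γ ![w, ⟨v, hv⟩] ![a, 0] ![o, 1]
      (by simp [Fin.sum_univ_two, Γ.marginal_zero, (Γ.isRule _).map_zero, hv1])
    simpa [Fin.sum_univ_two, (h𝒲 v hv).map_zero, hv1] using this

/-- The analogue of `efficiency_one_mul_add_le` for equilibria. -/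
theorem asymptoticEfficiency_mul_add_le (h𝒲 : ∀ w ∈ 𝒲, IsSubmodularRule w)
    (h1 : ∀ D : ℝ, 0 < D → ∃ w ∈ 𝒲, w 1 = D) (Γ : UtilityDesign 𝒲) (w : 𝒲) (a o : ℕ)
    (hD : 0 ≤ a * Γ.marginal w (a - 1) - o * Γ.marginal w a) :
    Γ.asymptoticEfficiency *
      ((w : ℕ → ℝ) o + (a * Γ.marginal w (a - 1) - o * Γ.marginal w a)) ≤ (w : ℕ → ℝ) a := by
  rcases hD.eq_or_lt with hD | hD
  · have := asymptoticEfficiency_mul_sum_le h𝒲 Γ (fun _ : Unit => w) (fun _ => a) (fun _ => o)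
      (by simpa using sub_nonneg.1 hD.le)
    rw [← hD, add_zero]
    simpa using this
  · obtain ⟨v, hv, hv1⟩ := h1 _ hD
    have := asymptoticEfficiency_mul_sum_le h𝒲 Γ ![w, ⟨v, hv⟩] ![a, 0] ![o, 1]
      (by simp [Fin.sum_univ_two, Γ.marginal_zero, hv1])
    simpa [Fin.sum_univ_two, (h𝒲 v hv).map_zero, hv1] using this

/-- An equilibrium can be spread along a chain, where it is reached within one round. -/
theorem efficiency_one_le_asymptoticEfficiency (h𝒲 : ∀ w ∈ 𝒲, IsSubmodularRule w)
    (hne : 𝒲.Nonempty) (Γ : UtilityDesign 𝒲) : Γ.efficiency 1 ≤ Γ.asymptoticEfficiency := by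
  have := nonempty_game hne
  refine le_ciInf fun G => G.le_ratio h𝒲 (G.limitOutcomes_nonempty Γ) fun α hα o ho => ?_
  exact efficiency_one_mul_sum_le h𝒲 Γ G.welfareRule (G.load α) (G.load o)
    ((Game.sum_mul_marginal_le_of_mem_limitOutcomes hα ho).trans
      (Finset.sum_le_sum fun r _ => Γ.mul_marginal_pred_le_rule _ _))

end Necessary

/-! ### Rules of bounded curvature -/

section Curvature

variable {c : ℝ}

theorem isSubmodularRule_of_mem {w : ℕ → ℝ} (hw : w ∈ curvatureClass c) : IsSubmodularRule w :=
  hw.1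

theorem le_increment_of_mem {w : ℕ → ℝ} (hw : w ∈ curvatureClass c) (n : ℕ) :
    (1 - c) * w 1 ≤ w (n + 1) - w n := by
  obtain ⟨hw, κ, hκ, hlim⟩ := hw
  have h1 := hw.pos 1 one_pos
  have hmono : Monotone fun n : ℕ => 1 - (w (n + 1) - w n) / w 1 := fun m n hmn =>
    sub_le_sub_left (div_le_div_of_nonneg_right (hw.antitone_increment hmn) h1.le) 1
  have h2 := (hmono.ge_of_tendsto hlim n).trans hκ
  rw [← le_div_iff₀ h1]
  linarith

/-- The extreme rule of curvature `c`: a multiple of `(1 - c) * j + c * min j 1`. -/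
def coverRule (c s : ℝ) (j : ℕ) : ℝ :=
  s * ((1 - c) * j + c * (min j 1 : ℕ))

theorem coverRule_zero (c s : ℝ) : coverRule c s 0 = 0 := by simp [coverRule]

theorem coverRule_succ (c s : ℝ) (j : ℕ) : coverRule c s (j + 1) = s * ((1 - c) * j + 1) := by
  rw [coverRule, min_eq_right (Nat.le_add_left 1 j)]
  push_cast
  ring

theorem coverRule_mem (hc0 : 0 ≤ c) (hc1 : c ≤ 1) {s : ℝ} (hs : 0 < s) :
    coverRule c s ∈ curvatureClass c := by
  have hc : 0 ≤ s * (1 - c) := mul_nonneg hs.le (by linarith)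
  refine ⟨⟨coverRule_zero c s, ?_, ?_, ?_⟩, c, le_rfl, ?_⟩
  · rintro (_ | j) hj
    · exact absurd hj (lt_irrefl _)
    · rw [coverRule_succ]
      have : 0 ≤ (1 - c) * (j : ℝ) := mul_nonneg (by linarith) j.cast_nonneg
      exact mul_pos hs (by linarith)
  · refine monotone_nat_of_le_succ ?_
    rintro (_ | j)
    · rw [coverRule_zero, coverRule_succ]; simpa using hs.le
    · rw [coverRule_succ, coverRule_succ]; push_cast; linarith
  · rintro (_ | j)
    · simp only [coverRule_zero, coverRule_succ, zero_add]
      push_cast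
      nlinarith [mul_nonneg hs.le hc0]
    · simp only [coverRule_succ]; push_cast; linarith
  · refine tendsto_const_nhds.congr' ?_
    filter_upwards [eventually_ge_atTop 1] with n hn
    obtain ⟨j, rfl⟩ := Nat.exists_eq_add_of_le' hn
    have h1 : coverRule c s 1 = s := by simpa using coverRule_succ c s 0
    rw [h1, coverRule_succ, coverRule_succ]
    push_cast
    field_simp
    ring

theorem exists_mem_curvatureClass (hc0 : 0 ≤ c) (hc1 : c ≤ 1) (D : ℝ) (hD : 0 < D) :
    ∃ w ∈ curvatureClass c, w 1 = D :=
  ⟨_, coverRule_mem hc0 hc1 hD, by simpa using coverRule_succ c D 0⟩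

theorem curvatureClass_nonempty (hc0 : 0 ≤ c) (hc1 : c ≤ 1) : (curvatureClass c).Nonempty :=
  ⟨_, coverRule_mem hc0 hc1 one_pos⟩

/-- The extreme rule as a member of the class. -/
def cover (hc0 : 0 ≤ c) (hc1 : c ≤ 1) {s : ℝ} (hs : 0 < s) : curvatureClass c :=
  ⟨coverRule c s, coverRule_mem hc0 hc1 hs⟩

theorem coe_cover_succ (hc0 : 0 ≤ c) (hc1 : c ≤ 1) {s : ℝ} (hs : 0 < s) (j : ℕ) :
    (cover hc0 hc1 hs : ℕ → ℝ) (j + 1) = s * ((1 - c) * j + 1) :=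
  coverRule_succ c s j

theorem marginal_cover_zero (hc0 : 0 ≤ c) (hc1 : c ≤ 1) {s : ℝ} (hs : 0 < s)
    (Γ : UtilityDesign (curvatureClass c)) : Γ.marginal (cover hc0 hc1 hs) 0 = s := by
  rw [Γ.marginal_zero, ← zero_add 1, coe_cover_succ]
  simp

/-- The conditions from one round for the extreme rule, with a single alternative user. -/
theorem efficiency_one_mul_cover_le (hc0 : 0 ≤ c) (hc1 : c ≤ 1) {s : ℝ} (hs : 0 < s)
    (Γ : UtilityDesign (curvatureClass c)) (a : ℕ) :
    Γ.efficiency 1 * (s + (Γ.rule (cover hc0 hc1 hs) (a + 1) -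
      Γ.marginal (cover hc0 hc1 hs) (a + 1))) ≤ s * ((1 - c) * a + 1) := by
  have h := efficiency_one_mul_add_le (fun _ => isSubmodularRule_of_mem)
    (exists_mem_curvatureClass hc0 hc1) Γ (cover hc0 hc1 hs) (a + 1) 1 (by
      rw [Nat.cast_one, one_mul, sub_nonneg, ← Γ.sum_marginal]
      refine le_trans ?_ (Finset.single_le_sum (fun j _ => Γ.marginal_nonneg _ j)
        (Finset.mem_range.2 a.lt_succ_self))
      exact Γ.antitone_marginal _ a.le_succ)
  rw [coe_cover_succ, coe_cover_succ] at h
  simpa using h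

/-- The conditions from equilibria for the extreme rule, with a single alternative user. -/
theorem asymptoticEfficiency_mul_cover_le (hc0 : 0 ≤ c) (hc1 : c ≤ 1) {s : ℝ} (hs : 0 < s)
    (Γ : UtilityDesign (curvatureClass c)) (a : ℕ) :
    Γ.asymptoticEfficiency * (s + ((a + 1) * Γ.marginal (cover hc0 hc1 hs) a -
      Γ.marginal (cover hc0 hc1 hs) (a + 1))) ≤ s * ((1 - c) * a + 1) := by
  have h := asymptoticEfficiency_mul_add_le (fun _ => isSubmodularRule_of_mem)
    (exists_mem_curvatureClass hc0 hc1) Γ (cover hc0 hc1 hs) (a + 1) 1 (by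
      have h1 := Γ.antitone_marginal (cover hc0 hc1 hs) a.le_succ
      have h2 := mul_nonneg a.cast_nonneg (Γ.marginal_nonneg (cover hc0 hc1 hs) a)
      rw [Nat.succ_eq_add_one] at h1
      rw [Nat.add_sub_cancel]
      push_cast
      linarith)
  rw [coe_cover_succ, coe_cover_succ] at h
  simpa using h

end Curvature

/-! ### The optimal guarantee after one round -/

section OneRound

variable {c : ℝ}

/-- Two users and an alternative third one. -/
theorem efficiency_one_le (hc0 : 0 ≤ c) (hc1 : c ≤ 1) (Γ : UtilityDesign (curvatureClass c)) :
    Γ.efficiency 1 ≤ 1 - c / 2 := by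
  have h := efficiency_one_mul_cover_le hc0 hc1 one_pos Γ 1
  have h0 := marginal_cover_zero hc0 hc1 one_pos Γ
  have h1 := Γ.antitone_marginal (cover hc0 hc1 one_pos) (show 1 ≤ 2 by norm_num)
  rw [← Γ.sum_marginal] at h
  simp only [Finset.sum_range_succ, Finset.sum_range_zero, h0] at h
  norm_num at h
  have h2 := mul_nonneg (Γ.efficiency_nonneg (fun _ => isSubmodularRule_of_mem) 1)
    (sub_nonneg.2 h1)
  linarith

/-- A design which is optimal for one round: the mean of the rule `w` and its linear minorant
of slope `(1 - c) * w 1`, normalized. -/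
noncomputable def oneRoundDesign (hc1 : c ≤ 1) :
    UtilityDesign (curvatureClass c) where
  rule w j := ((w : ℕ → ℝ) j + j * ((1 - c) * (w : ℕ → ℝ) 1)) / (2 - c)
  isRule w := by
    have hw := w.2.1
    have hc : 0 < 2 - c := by linarith
    have h1 : 0 ≤ (1 - c) * (w : ℕ → ℝ) 1 := mul_nonneg (by linarith) (hw.nonneg 1)
    refine ⟨by simp [hw.map_zero], fun j hj => ?_, fun i j hij => ?_, fun j => ?_⟩
    · have := mul_nonneg j.cast_nonneg h1
      exact div_pos (by linarith [hw.pos j hj]) hc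
    · have h2 : (i : ℝ) ≤ j := by exact_mod_cast hij
      exact div_le_div_of_nonneg_right (add_le_add (hw.mono hij)
        (mul_le_mul_of_nonneg_right h2 h1)) hc.le
    · rw [← sub_div, ← sub_div]
      refine div_le_div_of_nonneg_right ?_ hc.le
      have := hw.concave j
      push_cast
      linarith
  rule_one w := by
    have hc : 2 - c ≠ 0 := by linarith
    push_cast
    field_simp
    ring

theorem le_efficiency_one_oneRoundDesign (hc0 : 0 ≤ c) (hc1 : c ≤ 1) :
    1 - c / 2 ≤ (oneRoundDesign hc1).efficiency 1 := by
  refine UtilityDesign.le_efficiency_one _ (fun _ => isSubmodularRule_of_mem)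
    (curvatureClass_nonempty hc0 hc1) (by linarith) fun w o a => ?_
  have hc : 2 - c ≠ 0 := by linarith
  have h1 := w.2.1.le_tangent o a
  have h2 := mul_le_mul_of_nonneg_left (w.2.1.le_mul o) (sub_nonneg.2 hc1)
  have h3 := mul_le_mul_of_nonneg_left (le_increment_of_mem w.2 a) (Nat.cast_nonneg (α := ℝ) a)
  have h4 : (1 - c / 2) * (o * (oneRoundDesign hc1).marginal w a -
      (oneRoundDesign hc1).rule w a) =
      (o * ((w : ℕ → ℝ) (a + 1) - (w : ℕ → ℝ) a + (1 - c) * (w : ℕ → ℝ) 1) -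
        ((w : ℕ → ℝ) a + a * ((1 - c) * (w : ℕ → ℝ) 1))) / 2 := by
    simp only [UtilityDesign.marginal, oneRoundDesign]
    push_cast
    field_simp
    ring
  rw [h4]
  linarith

theorem optEfficiency_one (hc0 : 0 ≤ c) (hc1 : c ≤ 1) :
    optEfficiency (curvatureClass c) 1 = 1 - c / 2 := by
  have : Nonempty (UtilityDesign (curvatureClass c)) := ⟨oneRoundDesign hc1⟩
  refine le_antisymm (ciSup_le (efficiency_one_le hc0 hc1)) ?_
  exact (le_efficiency_one_oneRoundDesign hc0 hc1).trans
    (le_ciSup (f := fun Γ : UtilityDesign (curvatureClass c) => Γ.efficiency 1)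
      ⟨1 - c / 2, by rintro _ ⟨Γ, rfl⟩; exact efficiency_one_le hc0 hc1 Γ⟩ _)

/-- Optimality for one round bounds the second marginal of the extreme rule: with two users, the
efficiency condition shows that the third marginal is not smaller than the second one, and then
the condition with three users bounds them. -/
theorem marginal_cover_one_le (hc0 : 0 ≤ c) (hc1 : c ≤ 1) {s : ℝ} (hs : 0 < s)
    (Γ : UtilityDesign (curvatureClass c)) (hΓ : Γ.efficiency 1 = 1 - c / 2) :
    (2 - c) * Γ.marginal (cover hc0 hc1 hs) 1 ≤ s * (2 - 2 * c) := by
  have h2 := efficiency_one_mul_cover_le hc0 hc1 hs Γ 1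
  have h3 := efficiency_one_mul_cover_le hc0 hc1 hs Γ 2
  have h0 := marginal_cover_zero hc0 hc1 hs Γ
  have ha := Γ.antitone_marginal (cover hc0 hc1 hs) (show 1 ≤ 3 by norm_num)
  rw [← Γ.sum_marginal, hΓ] at h2 h3
  simp only [Finset.sum_range_succ, Finset.sum_range_zero, h0] at h2 h3
  norm_num at h2 h3
  have hc : 0 < 2 - c := by linarith
  set x := Γ.marginal (cover hc0 hc1 hs) 1
  set y := Γ.marginal (cover hc0 hc1 hs) 2
  set z := Γ.marginal (cover hc0 hc1 hs) 3
  have h4 : (2 - c) * (x - y) ≤ 0 := by linarith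
  have h5 := mul_le_mul_of_nonneg_left ha hc.le
  linarith

theorem asymptoticEfficiency_of_optimal_one_round (hc0 : 0 ≤ c) (hc1 : c ≤ 1)
    (Γ : UtilityDesign (curvatureClass c)) (hΓ : Γ.efficiency 1 = 1 - c / 2) :
    Γ.asymptoticEfficiency = 1 - c / 2 := by
  refine le_antisymm ?_ (hΓ ▸ efficiency_one_le_asymptoticEfficiency
    (fun _ => isSubmodularRule_of_mem) (curvatureClass_nonempty hc0 hc1) Γ)
  have h := asymptoticEfficiency_mul_cover_le hc0 hc1 one_pos Γ 0
  have h0 := marginal_cover_zero hc0 hc1 one_pos Γ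
  have h1 := marginal_cover_one_le hc0 hc1 one_pos Γ hΓ
  rw [h0] at h
  norm_num at h
  have h2 := mul_nonneg (Γ.asymptoticEfficiency_nonneg fun _ => isSubmodularRule_of_mem)
    (sub_nonneg.2 h1)
  have hc : 0 < 2 - c := by linarith
  have h3 := mul_le_mul_of_nonneg_left h hc.le
  linarith

end OneRound

/-! ### Scaled tails of the exponential series -/

/-- The tail `∑_{k > q} 1 / k!` of the series of `e`, multiplied by `q !`. Up to normalization, this
sequence is the equilibrium-optimal distribution rule for the welfare rule `min j 1`. -/
noncomputable def expTail (q : ℕ) : ℝ :=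
  q.factorial * (Real.exp 1 - ∑ k ∈ Finset.range (q + 1), 1 / (k.factorial : ℝ))

theorem expTail_zero : expTail 0 = Real.exp 1 - 1 := by simp [expTail]

theorem expTail_succ (q : ℕ) : expTail (q + 1) = (q + 1) * expTail q - 1 := by
  have h : ((q + 1).factorial : ℝ) ≠ 0 := by positivity
  rw [expTail, expTail, Finset.sum_range_succ _ (q + 1)]
  rw [← sub_sub, mul_sub, mul_one_div_cancel h, Nat.factorial_succ]
  push_cast
  ring

theorem expTail_nonneg (q : ℕ) : 0 ≤ expTail q := by
  have := Real.sum_le_exp_of_nonneg zero_le_one (q + 1)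
  simp only [one_pow] at this
  exact mul_nonneg (by positivity) (sub_nonneg.2 this)

theorem one_div_le_expTail (q : ℕ) : 1 / ((q : ℝ) + 1) ≤ expTail q := by
  have h1 := expTail_nonneg (q + 1)
  rw [expTail_succ] at h1
  rw [div_le_iff₀ (by positivity)]
  linarith

theorem mul_expTail_le_one (q : ℕ) : q * expTail q ≤ 1 := by
  have h := Real.exp_bound' zero_le_one le_rfl (Nat.succ_pos q)
  simp only [one_pow, one_mul, Nat.succ_eq_add_one] at h
  have h2 : expTail q ≤ (q + 2) / ((q + 1) * (q + 1)) := by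
    have hf : (0 : ℝ) < q.factorial := by positivity
    have := mul_le_mul_of_nonneg_left (sub_le_iff_le_add'.2 h) hf.le
    refine this.trans_eq ?_
    rw [Nat.factorial_succ]
    push_cast
    field_simp
    ring
  refine (mul_le_mul_of_nonneg_left h2 q.cast_nonneg).trans ?_
  rw [mul_div_assoc', div_le_one (by positivity)]
  linarith

theorem antitone_expTail : Antitone expTail := by
  refine antitone_nat_of_succ_le fun q => ?_
  rw [expTail_succ]
  linarith [mul_expTail_le_one q]

theorem exp_one_sub_one_pos : 0 < Real.exp 1 - 1 := by
  linarith [Real.add_one_lt_exp (one_ne_zero (α := ℝ))]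

/-- A bounded sequence with `γ (m + 1) ≥ (m + 1) * γ m - β` is at most `β * expTail`, as otherwise
the excess would grow like a factorial. -/
theorem le_mul_expTail {γ : ℕ → ℝ} {β B : ℝ} (hβ : 0 ≤ β)
    (h : ∀ m : ℕ, (m + 1) * γ m - β ≤ γ (m + 1)) (hB : ∀ m, γ m ≤ B) (m : ℕ) :
    γ m ≤ β * expTail m := by
  by_contra! hlt
  set δ : ℕ → ℝ := fun n => γ n - β * expTail n with hδ
  have hstep : ∀ n : ℕ, (n + 1) * δ n ≤ δ (n + 1) := by
    intro n
    simp only [hδ, expTail_succ]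
    linarith [h n]
  have hpos : 0 < δ m := sub_pos.2 hlt
  have hge : ∀ n, m ≤ n → δ m ≤ δ n := by
    intro n hn
    induction n, hn using Nat.le_induction with
    | base => exact le_rfl
    | succ n _ ih =>
      have := mul_nonneg (n.cast_nonneg (α := ℝ)) (hpos.le.trans ih)
      linarith [hstep n]
  obtain ⟨N, hN⟩ := exists_nat_gt (B / δ m)
  rw [div_lt_iff₀ hpos] at hN
  have h1 := hge (m + N) (Nat.le_add_right m N)
  have h2 := hstep (m + N)
  have h3 : δ (m + N + 1) ≤ B := by
    have := mul_nonneg hβ (expTail_nonneg (m + N + 1))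
    simp only [hδ]
    linarith [hB (m + N + 1)]
  have h4 : (N : ℝ) * δ m ≤ ((m + N : ℕ) + 1) * δ (m + N) :=
    mul_le_mul (by push_cast; linarith [m.cast_nonneg (α := ℝ)]) h1 hpos.le (by positivity)
  linarith

theorem mul_expTail_le {γ : ℕ → ℝ} {β : ℝ} (h : ∀ m : ℕ, (m + 1) * γ m - β ≤ γ (m + 1))
    (h0 : β * expTail 0 ≤ γ 0) (m : ℕ) : β * expTail m ≤ γ m := by
  induction m with
  | zero => exact h0
  | succ m ih =>
    rw [expTail_succ]
    have := mul_le_mul_of_nonneg_left ih (by positivity : (0 : ℝ) ≤ (m : ℝ) + 1)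
    linarith [h m]

/-! ### Mixtures of stretched distribution rules -/

section Mixture

/-- The marginals `expTail (j / b) / expTail 0` serve for the welfare rule `min j b`: they are those for
`min j 1`, stretched by the factor `b`. For `b > 1` better ones exist, but these
already meet the guarantee for `b = 1`. The definition is their mixture in the decomposition of a
concave rule `v` into rules `min j b` and a linear one. The sum extends over `b = k + 1 ≤ j` only: the
marginals for `b > j` are all `1`, so their weights telescope to the last summand. -/
noncomputable def mixtureMarginal (v : ℕ → ℝ) (j : ℕ) : ℝ :=
  ∑ k ∈ Finset.range j, ((v (k + 1) - v k) - (v (k + 2) - v (k + 1))) *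
    (expTail (j / (k + 1)) / expTail 0) + (v (j + 1) - v j)

theorem expTail_zero_pos : 0 < expTail 0 := by
  rw [expTail_zero]; exact exp_one_sub_one_pos

theorem mixtureMarginal_eq (v : ℕ → ℝ) {j N : ℕ} (h : j ≤ N) :
    mixtureMarginal v j = ∑ k ∈ Finset.range N, ((v (k + 1) - v k) - (v (k + 2) - v (k + 1))) *
      (expTail (j / (k + 1)) / expTail 0) + (v (N + 1) - v N) := by
  induction N, h using Nat.le_induction with
  | base => rfl
  | succ N hN ih =>
    rw [ih, Finset.sum_range_succ, Nat.div_eq_of_lt (Nat.lt_succ_of_le hN),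
      div_self expTail_zero_pos.ne']
    ring

/-- The decomposition of `v`, up to `N`, into rules `min j b` and a linear one. -/
theorem sum_mul_min_add (v : ℕ → ℝ) (h0 : v 0 = 0) {j N : ℕ} (h : j ≤ N) :
    ∑ k ∈ Finset.range N, ((v (k + 1) - v k) - (v (k + 2) - v (k + 1))) * (min j (k + 1) : ℕ) +
      (v (N + 1) - v N) * j = v j := by
  induction N, h using Nat.le_induction with
  | base =>
    have : ∀ k ∈ Finset.range j, ((v (k + 1) - v k) - (v (k + 2) - v (k + 1))) *
        (min j (k + 1) : ℕ) =
        ((v (k + 1) - v k) - (v (k + 2) - v (k + 1))) * (k + 1) := fun k hk => by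
      rw [min_eq_right (Finset.mem_range.1 hk)]; push_cast; rfl
    rw [Finset.sum_congr rfl this]
    clear this
    induction j with
    | zero => simp [h0]
    | succ j ih => rw [Finset.sum_range_succ]; push_cast; linarith
  | succ N hN ih =>
    rw [Finset.sum_range_succ, min_eq_left (hN.trans N.le_succ)]
    linarith

/-- The smoothness inequality for the welfare rule `min j b`. The worst number of alternative
users is `o = b`, and equality holds if moreover `b` divides `a`. -/
theorem min_le_smoothness (b a o : ℕ) (hb : 0 < b) :
    ((min o b : ℕ) : ℝ) ≤ o * (expTail (a / b) / expTail 0) -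
      a * (expTail ((a - 1) / b) / expTail 0) +
      Real.exp 1 / (Real.exp 1 - 1) * (min a b : ℕ) := by
  have he := exp_one_sub_one_pos
  have hlam : Real.exp 1 / (Real.exp 1 - 1) = 1 + 1 / (Real.exp 1 - 1) := by
    field_simp; ring
  rw [hlam]
  set μ : ℝ := 1 / (Real.exp 1 - 1) with hμ
  have hμ0 : 0 < μ := by positivity
  set g : ℕ → ℝ := fun q => expTail q / expTail 0 with hg
  have hg0 : g 0 = 1 := div_self expTail_zero_pos.ne'
  have hgn : ∀ q, 0 ≤ g q := fun q => div_nonneg (expTail_nonneg q) (expTail_nonneg 0)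
  have hg1 : ∀ q, g q ≤ 1 := fun q =>
    div_le_one_of_le₀ (antitone_expTail (Nat.zero_le q)) (expTail_nonneg 0)
  have hgs : ∀ q : ℕ, g (q + 1) = (q + 1) * g q - μ := fun q => by
    simp only [hg, hμ, expTail_succ, expTail_zero]; ring
  have hgq : ∀ q : ℕ, q * g q ≤ μ := fun q => by
    have := div_le_div_of_nonneg_right (mul_expTail_le_one q) (expTail_nonneg 0)
    rw [mul_div_assoc, expTail_zero] at this
    simpa only [hg, hμ, expTail_zero] using this
  change _ ≤ o * g (a / b) - a * g ((a - 1) / b) + _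
  have hworst : b * g (a / b) - b ≤ o * g (a / b) - (min o b : ℕ) := by
    rcases le_total o b with h | h
    · rw [min_eq_left h]
      have h' : (o : ℝ) ≤ b := by exact_mod_cast h
      nlinarith [hg1 (a / b)]
    · rw [min_eq_right h]
      have h' : (b : ℝ) ≤ o := by exact_mod_cast h
      nlinarith [hgn (a / b)]
  suffices h : (b : ℝ) ≤ b * g (a / b) - a * g ((a - 1) / b) + (1 + μ) * (min a b : ℕ) by
    linarith
  -- The recursion `hgs` settles `b ∣ a`. Otherwise `a` and `a - 1` have the same quotient, and `hgq`,
  -- which says that `g` is antitone, is enough.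
  rcases Nat.eq_zero_or_pos a with rfl | ha
  · simp [hg0]
  rcases lt_or_ge a b with hab | hab
  · rw [Nat.div_eq_of_lt hab, Nat.div_eq_of_lt (by omega), min_eq_left hab.le, hg0]
    have := mul_nonneg hμ0.le a.cast_nonneg
    linarith
  rw [min_eq_right hab]
  by_cases hdvd : b ∣ a
  · obtain ⟨q, rfl⟩ := hdvd
    obtain ⟨q, rfl⟩ : ∃ p, q = p + 1 := ⟨q - 1, by
      have : q ≠ 0 := by rintro rfl; simp at ha
      omega⟩
    have h1 : (b * (q + 1) - 1) / b = q := by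
      rw [Nat.div_eq_iff hb]
      constructor <;> (rw [Nat.mul_add, Nat.mul_comm]; omega)
    rw [Nat.mul_div_cancel_left _ hb, h1, hgs]
    push_cast
    linarith
  · have h1 : (a - 1) / b = a / b := by
      have h2 : ¬ b ∣ a - 1 + 1 := by rwa [Nat.sub_add_cancel ha]
      have h3 := Nat.succ_div_of_not_dvd h2
      rw [Nat.sub_add_cancel ha] at h3
      exact h3.symm
    rw [h1]
    have h2 : (a : ℝ) ≤ b * (a / b : ℕ) + b := by
      have := Nat.div_add_mod a b
      have := Nat.mod_lt a hb
      exact_mod_cast (by omega : a ≤ b * (a / b) + b)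
    have h3 := mul_le_mul_of_nonneg_left (hgq (a / b)) (b.cast_nonneg (α := ℝ))
    have h4 := mul_le_mul_of_nonneg_right h2 (hgn (a / b))
    linarith

variable {v : ℕ → ℝ}

theorem mixtureMarginal_zero (h0 : v 0 = 0) : mixtureMarginal v 0 = v 1 := by
  simp [mixtureMarginal, h0]

theorem mixtureMarginal_nonneg (hmono : Monotone v)
    (hconc : ∀ j, v (j + 2) - v (j + 1) ≤ v (j + 1) - v j) (j : ℕ) : 0 ≤ mixtureMarginal v j :=
  add_nonneg (Finset.sum_nonneg fun k _ => mul_nonneg (sub_nonneg.2 (hconc k))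
    (div_nonneg (expTail_nonneg _) (expTail_nonneg 0))) (sub_nonneg.2 (hmono j.le_succ))

theorem antitone_mixtureMarginal (hconc : ∀ j, v (j + 2) - v (j + 1) ≤ v (j + 1) - v j) :
    Antitone (mixtureMarginal v) := by
  refine antitone_nat_of_succ_le fun j => ?_
  rw [mixtureMarginal_eq v j.le_succ, mixtureMarginal]
  refine add_le_add_left (Finset.sum_le_sum fun k _ => ?_) _
  exact mul_le_mul_of_nonneg_left (div_le_div_of_nonneg_right
    (antitone_expTail (Nat.div_le_div_right j.le_succ)) (expTail_nonneg 0))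
    (sub_nonneg.2 (hconc k))

/-- The smoothness inequality for mixtures, inherited from the rules `min j b`. -/
theorem le_smoothness_mixtureMarginal (h0 : v 0 = 0) (hmono : Monotone v)
    (hconc : ∀ j, v (j + 2) - v (j + 1) ≤ v (j + 1) - v j) (a o : ℕ) :
    v o ≤ o * mixtureMarginal v a - a * mixtureMarginal v (a - 1) +
      Real.exp 1 / (Real.exp 1 - 1) * v a := by
  have ha : a ≤ a + o := Nat.le_add_right a o
  rw [← sum_mul_min_add v h0 (Nat.le_add_left o a), ← sum_mul_min_add v h0 ha,
    mixtureMarginal_eq v ha, mixtureMarginal_eq v ((a.sub_le 1).trans ha)]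
  have h1 := Finset.sum_le_sum fun k (_ : k ∈ Finset.range (a + o)) =>
    mul_le_mul_of_nonneg_left (min_le_smoothness (k + 1) a o k.succ_pos)
      (sub_nonneg.2 (hconc k))
  have h2 : ∑ k ∈ Finset.range (a + o), ((v (k + 1) - v k) - (v (k + 2) - v (k + 1))) *
      (o * (expTail (a / (k + 1)) / expTail 0) - a * (expTail ((a - 1) / (k + 1)) / expTail 0) +
        Real.exp 1 / (Real.exp 1 - 1) * (min a (k + 1) : ℕ)) =
      o * (∑ k ∈ Finset.range (a + o), ((v (k + 1) - v k) - (v (k + 2) - v (k + 1))) *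
        (expTail (a / (k + 1)) / expTail 0)) -
      a * (∑ k ∈ Finset.range (a + o), ((v (k + 1) - v k) - (v (k + 2) - v (k + 1))) *
        (expTail ((a - 1) / (k + 1)) / expTail 0)) +
      Real.exp 1 / (Real.exp 1 - 1) *
        ∑ k ∈ Finset.range (a + o), ((v (k + 1) - v k) - (v (k + 2) - v (k + 1))) *
          (min a (k + 1) : ℕ) := by
    simp only [Finset.mul_sum, ← Finset.sum_sub_distrib, ← Finset.sum_add_distrib]
    exact Finset.sum_congr rfl fun k _ => by ring
  rw [h2] at h1
  have he := exp_one_sub_one_pos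
  have hlam : 1 ≤ Real.exp 1 / (Real.exp 1 - 1) := by
    rw [one_le_div he]; linarith
  have h3 := mul_nonneg (sub_nonneg.2 hlam) (mul_nonneg (sub_nonneg.2 (hmono (a + o).le_succ))
    (a.cast_nonneg (α := ℝ)))
  rw [Nat.succ_eq_add_one] at h3
  linarith

end Mixture

/-! ### The optimal guarantee for equilibria -/

theorem isSubmodularRule_sum_range {f : ℕ → ℝ} (hf : Antitone f) (hpos : 0 < f 0)
    (hnn : ∀ j, 0 ≤ f j) : IsSubmodularRule fun j => ∑ i ∈ Finset.range j, f i where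
  map_zero := Finset.sum_range_zero f
  pos j hj := Finset.sum_pos' (fun i _ => hnn i) ⟨0, Finset.mem_range.2 hj, hpos⟩
  mono := monotone_nat_of_le_succ fun j => by
    rw [Finset.sum_range_succ]; exact le_add_of_nonneg_right (hnn j)
  concave j := by
    simp only [Finset.sum_range_succ]
    linarith [hf j.le_succ]

section Asymptotic

variable {c : ℝ}

/-- The excess of a rule of curvature at most `c` over its linear minorant. -/
def excess (c : ℝ) (w : ℕ → ℝ) (j : ℕ) : ℝ :=
  w j - j * ((1 - c) * w 1)

theorem excess_zero {w : ℕ → ℝ} (hw : w ∈ curvatureClass c) : excess c w 0 = 0 := by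
  simp [excess, hw.1.map_zero]

theorem excess_one (w : ℕ → ℝ) : excess c w 1 = c * w 1 := by
  simp [excess]; ring

theorem monotone_excess {w : ℕ → ℝ} (hw : w ∈ curvatureClass c) : Monotone (excess c w) :=
  monotone_nat_of_le_succ fun j => by
    have := le_increment_of_mem hw j
    simp only [excess]
    push_cast
    linarith

theorem excess_concave {w : ℕ → ℝ} (hw : w ∈ curvatureClass c) (j : ℕ) :
    excess c w (j + 2) - excess c w (j + 1) ≤ excess c w (j + 1) - excess c w j := by
  have := hw.1.concave j
  simp only [excess]
  push_cast
  linarith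

/-- The marginals of the asymptotically optimal design. The weights of the linear part and of the
excess of `w` are chosen so that both meet the same guarantee `1 - c / e`. -/
noncomputable def asymptoticMarginal (c : ℝ) (w : ℕ → ℝ) (j : ℕ) : ℝ :=
  (Real.exp 1 * ((1 - c) * w 1) + (Real.exp 1 - 1) * mixtureMarginal (excess c w) j) /
    (Real.exp 1 - c)

theorem asymptoticMarginal_zero (hc1 : c ≤ 1) {w : ℕ → ℝ} (hw : w ∈ curvatureClass c) :
    asymptoticMarginal c w 0 = w 1 := by
  have he := exp_one_sub_one_pos
  have hc : Real.exp 1 - c ≠ 0 := by linarith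
  rw [asymptoticMarginal, mixtureMarginal_zero (excess_zero hw), excess_one, div_eq_iff hc]
  ring

theorem asymptoticMarginal_nonneg (hc1 : c ≤ 1) {w : ℕ → ℝ} (hw : w ∈ curvatureClass c) (j : ℕ) :
    0 ≤ asymptoticMarginal c w j := by
  have he := exp_one_sub_one_pos
  have h1 := mul_nonneg (sub_nonneg.2 hc1) (hw.1.nonneg 1)
  have h2 := mixtureMarginal_nonneg (monotone_excess hw) (excess_concave hw) j
  exact div_nonneg (add_nonneg (mul_nonneg (Real.exp_pos 1).le h1) (mul_nonneg he.le h2))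
    (by linarith)

theorem antitone_asymptoticMarginal (hc1 : c ≤ 1) {w : ℕ → ℝ} (hw : w ∈ curvatureClass c) :
    Antitone (asymptoticMarginal c w) := fun i j hij => by
  have he := exp_one_sub_one_pos
  exact div_le_div_of_nonneg_right (add_le_add_right (mul_le_mul_of_nonneg_left
    (antitone_mixtureMarginal (excess_concave hw) hij) he.le) _) (by linarith)

/-- A design which is optimal for equilibria. -/
noncomputable def asymptoticDesign (hc1 : c ≤ 1) : UtilityDesign (curvatureClass c) where
  rule w j := ∑ i ∈ Finset.range j, asymptoticMarginal c w i
  isRule w := isSubmodularRule_sum_range (antitone_asymptoticMarginal hc1 w.2)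
    (by rw [asymptoticMarginal_zero hc1 w.2]; exact w.2.1.pos 1 one_pos)
    (asymptoticMarginal_nonneg hc1 w.2)
  rule_one w := by simp [asymptoticMarginal_zero hc1 w.2]

theorem marginal_asymptoticDesign (hc1 : c ≤ 1) (w : curvatureClass c) (j : ℕ) :
    (asymptoticDesign hc1).marginal w j = asymptoticMarginal c w j := by
  simp [UtilityDesign.marginal, asymptoticDesign, Finset.sum_range_succ]

theorem le_asymptoticEfficiency_asymptoticDesign (hc0 : 0 ≤ c) (hc1 : c ≤ 1) :
    1 - c / Real.exp 1 ≤ (asymptoticDesign hc1).asymptoticEfficiency := by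
  have he := exp_one_sub_one_pos
  have he0 := Real.exp_pos 1
  have hc : 0 < Real.exp 1 - c := by linarith
  have hρ : 1 - c / Real.exp 1 = (Real.exp 1 - c) / Real.exp 1 := by field_simp
  rw [hρ]
  refine UtilityDesign.le_asymptoticEfficiency _ (fun _ => isSubmodularRule_of_mem)
    (curvatureClass_nonempty hc0 hc1) (by positivity) fun w o a => ?_
  rw [marginal_asymptoticDesign, marginal_asymptoticDesign]
  have h1 := le_smoothness_mixtureMarginal (excess_zero w.2) (monotone_excess w.2)
    (excess_concave w.2) a o
  have h2 : excess c w o ≤ o * (c * (w : ℕ → ℝ) 1) := by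
    have := w.2.1.le_mul o
    simp only [excess]
    linarith
  have h3 := mul_le_mul_of_nonneg_left h2 (sub_nonneg.2 hc1)
  have h4 := mul_le_mul_of_nonneg_left h1 he.le
  have h5 : (Real.exp 1 - 1) * (o * mixtureMarginal (excess c w) a -
      a * mixtureMarginal (excess c w) (a - 1) +
      Real.exp 1 / (Real.exp 1 - 1) * excess c w a) = (Real.exp 1 - 1) *
      (o * mixtureMarginal (excess c w) a - a * mixtureMarginal (excess c w) (a - 1)) +
      Real.exp 1 * excess c w a := by
    field_simp
  rw [h5] at h4
  set X := mixtureMarginal (excess c w) a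
  set Y := mixtureMarginal (excess c w) (a - 1)
  have h6 : (Real.exp 1 - c) / Real.exp 1 * (o * asymptoticMarginal c w a -
      a * asymptoticMarginal c w (a - 1)) + (w : ℕ → ℝ) a =
      (((o : ℝ) - a) * (Real.exp 1 * ((1 - c) * (w : ℕ → ℝ) 1)) +
        (Real.exp 1 - 1) * (o * X - a * Y) + Real.exp 1 * (w : ℕ → ℝ) a) / Real.exp 1 := by
    simp only [asymptoticMarginal]
    field_simp
    ring
  rw [h6, div_mul_eq_mul_div]
  refine div_le_div_of_nonneg_right ?_ he0.le
  simp only [excess] at h3 h4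
  linarith

/-! ### The extreme rule at equilibrium -/

theorem asymptoticEfficiency_le_one (hc0 : 0 ≤ c) (hc1 : c ≤ 1)
    (Γ : UtilityDesign (curvatureClass c)) : Γ.asymptoticEfficiency ≤ 1 := by
  have h0 := marginal_cover_zero hc0 hc1 one_pos Γ
  have h := asymptoticEfficiency_mul_add_le (fun _ => isSubmodularRule_of_mem)
    (exists_mem_curvatureClass hc0 hc1) Γ (cover hc0 hc1 one_pos) 1 0 (by simp [h0])
  have h1 := coe_cover_succ hc0 hc1 one_pos 0
  have h2 : (cover hc0 hc1 one_pos : ℕ → ℝ) 0 = 0 := coverRule_zero c 1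
  rw [zero_add] at h1
  rw [h1, h2] at h
  simpa [h0] using h

/-- The equilibrium conditions of the extreme rule as a recursion. -/
theorem recursion_marginal_cover (hc0 : 0 ≤ c) (hc1 : c ≤ 1)
    (Γ : UtilityDesign (curvatureClass c)) (m : ℕ) :
    (m + 1) * (Γ.asymptoticEfficiency * Γ.marginal (cover hc0 hc1 one_pos) m - (1 - c)) -
      (1 - Γ.asymptoticEfficiency) ≤
      Γ.asymptoticEfficiency * Γ.marginal (cover hc0 hc1 one_pos) (m + 1) - (1 - c) := by
  linarith [asymptoticEfficiency_mul_cover_le hc0 hc1 one_pos Γ m]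

theorem marginal_cover_le (hc0 : 0 ≤ c) (hc1 : c ≤ 1)
    (Γ : UtilityDesign (curvatureClass c)) (m : ℕ) :
    Γ.asymptoticEfficiency * Γ.marginal (cover hc0 hc1 one_pos) m - (1 - c) ≤
      (1 - Γ.asymptoticEfficiency) * expTail m := by
  refine le_mul_expTail (B := Γ.asymptoticEfficiency)
    (γ := fun m => Γ.asymptoticEfficiency * Γ.marginal (cover hc0 hc1 one_pos) m - (1 - c))
    (sub_nonneg.2 (asymptoticEfficiency_le_one hc0 hc1 Γ))
    (recursion_marginal_cover hc0 hc1 Γ) (fun m => ?_) m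
  have h1 := Γ.antitone_marginal (cover hc0 hc1 one_pos) (Nat.zero_le m)
  rw [marginal_cover_zero] at h1
  have h2 := mul_le_mul_of_nonneg_left h1
    (Γ.asymptoticEfficiency_nonneg fun _ => isSubmodularRule_of_mem)
  linarith

theorem asymptoticEfficiency_le_one_sub (hc0 : 0 ≤ c) (hc1 : c ≤ 1)
    (Γ : UtilityDesign (curvatureClass c)) : Γ.asymptoticEfficiency ≤ 1 - c / Real.exp 1 := by
  have h := marginal_cover_le hc0 hc1 Γ 0
  rw [marginal_cover_zero, expTail_zero] at h
  have he0 := Real.exp_pos 1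
  have hρ : 1 - c / Real.exp 1 = (Real.exp 1 - c) / Real.exp 1 := by field_simp
  rw [hρ, le_div_iff₀ he0]
  linarith

theorem optAsymptoticEfficiency_eq (hc0 : 0 ≤ c) (hc1 : c ≤ 1) :
    optAsymptoticEfficiency (curvatureClass c) = 1 - c / Real.exp 1 := by
  have : Nonempty (UtilityDesign (curvatureClass c)) := ⟨asymptoticDesign hc1⟩
  refine le_antisymm (ciSup_le (asymptoticEfficiency_le_one_sub hc0 hc1)) ?_
  exact (le_asymptoticEfficiency_asymptoticDesign hc0 hc1).trans
    (le_ciSup (f := fun Γ : UtilityDesign (curvatureClass c) => Γ.asymptoticEfficiency)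
      ⟨1 - c / Real.exp 1,
        by rintro _ ⟨Γ, rfl⟩; exact asymptoticEfficiency_le_one_sub hc0 hc1 Γ⟩ _)

/-- Asymptotic optimality determines the distribution rule of the extreme rule. -/
theorem marginal_cover_of_optimal (hc0 : 0 ≤ c) (hc1 : c ≤ 1)
    (Γ : UtilityDesign (curvatureClass c)) (hΓ : Γ.asymptoticEfficiency = 1 - c / Real.exp 1)
    (m : ℕ) : (Real.exp 1 - c) * Γ.marginal (cover hc0 hc1 one_pos) m =
      (1 - c) * Real.exp 1 + c * expTail m := by
  have he0 := Real.exp_pos 1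
  have h := le_antisymm (marginal_cover_le hc0 hc1 Γ m)
    (mul_expTail_le (γ := fun m => Γ.asymptoticEfficiency *
      Γ.marginal (cover hc0 hc1 one_pos) m - (1 - c)) (recursion_marginal_cover hc0 hc1 Γ)
      (by
        simp only [marginal_cover_zero, expTail_zero, hΓ]
        field_simp
        linarith) m)
  rw [hΓ] at h
  field_simp at h
  linarith

theorem efficiency_one_le_of_asymptotically_optimal (hc0 : 0 ≤ c) (hc1 : c ≤ 1)
    (Γ : UtilityDesign (curvatureClass c)) (hΓ : Γ.asymptoticEfficiency = 1 - c / Real.exp 1) :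
    Γ.efficiency 1 ≤ 1 + (c - 3) * c / ((2 - c) * Real.exp 1 + c) := by
  have he := exp_one_sub_one_pos
  have h := efficiency_one_mul_cover_le hc0 hc1 one_pos Γ 1
  have h0 := marginal_cover_zero hc0 hc1 one_pos Γ
  have h1 := marginal_cover_of_optimal hc0 hc1 Γ hΓ 1
  have h2 := marginal_cover_of_optimal hc0 hc1 Γ hΓ 2
  have t1 := expTail_succ 0
  have t2 := expTail_succ 1
  rw [expTail_zero] at t1
  norm_num at t1 t2
  rw [t2, t1] at h2
  rw [t1] at h1
  rw [← Γ.sum_marginal] at h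
  simp only [Finset.sum_range_succ, Finset.sum_range_zero, h0] at h
  norm_num at h
  set x := Γ.marginal (cover hc0 hc1 one_pos) 1
  set y := Γ.marginal (cover hc0 hc1 one_pos) 2
  have hpos : 0 < (2 - c) * Real.exp 1 + c := by nlinarith [Real.exp_pos 1]
  have hc : 0 < Real.exp 1 - c := by linarith
  have h3 : 1 + (c - 3) * c / ((2 - c) * Real.exp 1 + c) =
      ((2 - c) * (Real.exp 1 - c)) / ((2 - c) * Real.exp 1 + c) := by
    field_simp; ring
  have h4 : (Real.exp 1 - c) * (1 + (1 + x - y)) = (2 - c) * Real.exp 1 + c := by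
    linarith
  rw [h3, le_div_iff₀ hpos, ← h4]
  have h5 := mul_le_mul_of_nonneg_left h hc.le
  linarith

theorem formula_lt (hc0 : 0 < c) (hc1 : c ≤ 1) :
    1 + (c - 3) * c / ((2 - c) * Real.exp 1 + c) < 1 - c / 2 := by
  have he := exp_one_sub_one_pos
  have he3 := Real.exp_one_lt_d9
  have hpos : 0 < (2 - c) * Real.exp 1 + c := by nlinarith [Real.exp_pos 1]
  have h : (c - 3) * c / ((2 - c) * Real.exp 1 + c) < -(c / 2) := by
    rw [div_lt_iff₀ hpos]
    have : 0 < c * ((2 - c) * (3 - Real.exp 1)) :=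
      mul_pos hc0 (mul_pos (by linarith) (by linarith))
    linarith
  linarith

/-- For curvature `1` the forced marginals of the extreme rule decay like the terms of
the harmonic series, so that its utility is unbounded while its welfare is not. -/
theorem efficiency_one_eq_zero (Γ : UtilityDesign (curvatureClass 1))
    (hΓ : Γ.asymptoticEfficiency = 1 - 1 / Real.exp 1) : Γ.efficiency 1 = 0 := by
  have he := exp_one_sub_one_pos
  refine le_antisymm ?_ (Γ.efficiency_nonneg (fun _ => isSubmodularRule_of_mem) 1)
  by_contra! hpos
  set w := cover zero_le_one (le_refl (1 : ℝ)) one_pos with hw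
  have hw0 : (w : ℕ → ℝ) 0 = 0 := coverRule_zero 1 1
  have hbound : ∀ n : ℕ, Γ.efficiency 1 * Γ.rule w n ≤ 1 := by
    intro n
    have h := efficiency_one_mul_add_le (fun _ => isSubmodularRule_of_mem)
      (exists_mem_curvatureClass zero_le_one le_rfl) Γ w n 0
      (by simpa using (Γ.isRule w).nonneg n)
    rw [hw0] at h
    refine le_trans (by simpa using h) ?_
    rcases n with _ | n
    · rw [hw0]; exact zero_le_one
    · rw [hw, coe_cover_succ]; simp
  have hmarg : ∀ m : ℕ, 1 / ((m : ℝ) + 1) ≤ (Real.exp 1 - 1) * Γ.marginal w m := by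
    intro m
    rw [marginal_cover_of_optimal zero_le_one le_rfl Γ hΓ m]
    simpa using one_div_le_expTail m
  obtain ⟨n, hn⟩ := (Real.tendsto_sum_range_one_div_nat_succ_atTop.eventually_gt_atTop
    ((Real.exp 1 - 1) / Γ.efficiency 1)).exists
  rw [div_lt_iff₀ hpos] at hn
  have h1 := Finset.sum_le_sum fun m (_ : m ∈ Finset.range n) => hmarg m
  rw [← Finset.mul_sum, Γ.sum_marginal] at h1
  have h2 := mul_le_mul_of_nonneg_right h1 hpos.le
  have h3 := mul_le_mul_of_nonneg_left (hbound n) he.le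
  linarith

end Asymptotic

end ResourceAllocation

theorem theorem2 (c : ℝ) (hc0 : 0 ≤ c) (hc1 : c ≤ 1) :
    -- both optimal guarantees are attained by some design
    (∃ Γ : ResourceAllocation.UtilityDesign (ResourceAllocation.curvatureClass c),
      Γ.efficiency 1 =
        ResourceAllocation.optEfficiency (ResourceAllocation.curvatureClass c) 1) ∧
    (∃ Γ : ResourceAllocation.UtilityDesign (ResourceAllocation.curvatureClass c),
      Γ.asymptoticEfficiency =
        ResourceAllocation.optAsymptoticEfficiency (ResourceAllocation.curvatureClass c)) ∧
    -- the optimal one-round guarantee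
    ResourceAllocation.optEfficiency (ResourceAllocation.curvatureClass c) 1 = 1 - c / 2 ∧
    -- asymptotic guarantee of the designs that are optimal for one round
    (∀ Γ : ResourceAllocation.UtilityDesign (ResourceAllocation.curvatureClass c),
      Γ.efficiency 1 =
        ResourceAllocation.optEfficiency (ResourceAllocation.curvatureClass c) 1 →
      Γ.asymptoticEfficiency = 1 - c / 2) ∧
    -- one-round guarantee of the designs that are asymptotically optimal
    (∀ Γ : ResourceAllocation.UtilityDesign (ResourceAllocation.curvatureClass c),
      Γ.asymptoticEfficiency =
        ResourceAllocation.optAsymptoticEfficiency (ResourceAllocation.curvatureClass c) →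
      Γ.efficiency 1 ≤ 1 + (c - 3) * c / ((2 - c) * Real.exp 1 + c) ∧
      (0 < c → Γ.efficiency 1 <
        ResourceAllocation.optEfficiency (ResourceAllocation.curvatureClass c) 1) ∧
      (c = 1 → Γ.efficiency 1 = 0)) := by
  rw [ResourceAllocation.optEfficiency_one hc0 hc1,
    ResourceAllocation.optAsymptoticEfficiency_eq hc0 hc1]
  refine ⟨⟨ResourceAllocation.oneRoundDesign hc1, le_antisymm
      (ResourceAllocation.efficiency_one_le hc0 hc1 _)
      (ResourceAllocation.le_efficiency_one_oneRoundDesign hc0 hc1)⟩,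
    ⟨ResourceAllocation.asymptoticDesign hc1, le_antisymm
      (ResourceAllocation.asymptoticEfficiency_le_one_sub hc0 hc1 _)
      (ResourceAllocation.le_asymptoticEfficiency_asymptoticDesign hc0 hc1)⟩, rfl,
    ResourceAllocation.asymptoticEfficiency_of_optimal_one_round hc0 hc1, fun Γ hΓ => ?_⟩
  have h := ResourceAllocation.efficiency_one_le_of_asymptotically_optimal hc0 hc1 Γ hΓ
  refine ⟨h, fun hc => h.trans_lt (ResourceAllocation.formula_lt hc hc1), ?_⟩
  rintro rfl
  exact ResourceAllocation.efficiency_one_eq_zero Γ hΓ
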